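/- Let $U$ be a finite unit interval order, i.e. a finite poset isomorphic to a finite set of real numbers ordered by $u\succ w$ iff $u\ge w+1$. Write $u\sim w$ if neither $u\prec w$ nor $w\prec u$ (so $u\sim u$), let $G=\mathrm{inc}(U)$ be the incomparability graph of $U$ (vertex set $U$, two vertices adjacent iff they are not comparable), and regard the elements of $U$ as commuting variables. Let $\Lambda$ be the ring of symmetric functions over $\mathbb{R}$ in countably many variables, and let $f\mapsto f^U$ be the ring homomorphism of $\mathbb{R}$-algebras $\Lambda\to\mathbb{R}[U]$ that sends, for each $i\ge 1$, the elementary symmetric function $e_i$ to $$e_i^U=\sum_{S}\ \prod_{v\in S}v ,$$ where $S$ runs over the $i$-element stable sets of $G$. For $r\ge 0$ let $E_r^U$ be the set of all chains $(\varepsilon_1\prec\varepsilon_2\prec\dots\prec\varepsilon_r)$ of length $r$ in $U$. For natural numbers $l,k\ge 0$ let $$M^U_{2^l,1^k}=\{(\vec\xi,\vec\varepsilon)\in E_l^U\times E_{k+l}^U \mid \text{there are } 1\le i_1<i_2<\dots<i_l\le k+l \text{ with } \xi_j\sim\varepsilon_{i_j}\text{ for } 1\le j\le l\}.$$ Then the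 image $m^U_{2^l,1^k}$ of the monomial symmetric function $m_{2^l,1^k}\in\Lambda$ is $$m^U_{2^l,1^k}=\sum_{(\vec\xi,\vec\varepsilon)\in M^U_{2^l,1^k}}\xi_1\cdots\xi_l\cdot\varepsilon_1\cdots\varepsilon_{k+l}.$$ Consequently, if $n=|U|$ and $X_{G}=\sum_\lambda c_\lambda(U)\, e_\lambda$ is the expansion of the chromatic symmetric function $X_G=\sum_{c}\prod_{v\in U}x_{c(v)}$ (sum over all proper colorings $c:U\to\mathbb{N}$ of $G$) in the basis of the elementary symmetric functions $e_\lambda=\prod_i e_{\lambda_i}$, then $c_{2^k,1^{n-2k}}(U)\ge 0$ for every $k\ge 0$ with $2k\le n$. -/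

import Mathlib

noncomputable section

namespace ChromSym

open scoped Classical

/-! ### Symmetric functions in the variables `x₀, x₁, x₂, …` -/

/-- All monomials of the power series `f` have total degree at most `D`. -/
def DegLE (D : ℕ) (f : MvPowerSeries ℕ ℝ) : Prop :=
  ∀ d : ℕ →₀ ℕ, MvPowerSeries.coeff d f ≠ 0 → d.degree ≤ D

theorem DegLE.mono {D D' : ℕ} (h : D ≤ D') {f : MvPowerSeries ℕ ℝ} (hf : DegLE D f) :
    DegLE D' f := fun d hd => (hf d hd).trans h

theorem DegLE.add {D : ℕ} {f g : MvPowerSeries ℕ ℝ} (hf : DegLE D f) (hg : DegLE D g) :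
    DegLE D (f + g) := by
  intro d hd
  by_contra hlt
  have h1 : MvPowerSeries.coeff d f = 0 := by
    by_contra h; exact hlt (hf d h)
  have h2 : MvPowerSeries.coeff d g = 0 := by
    by_contra h; exact hlt (hg d h)
  exact hd (by simp [h1, h2])

theorem DegLE.mul {D D' : ℕ} {f g : MvPowerSeries ℕ ℝ} (hf : DegLE D f) (hg : DegLE D' g) :
    DegLE (D + D') (f * g) := by
  intro d hd
  rw [MvPowerSeries.coeff_mul] at hd
  obtain ⟨p, hp, hne⟩ := Finset.exists_ne_zero_of_sum_ne_zero hd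
  have hp' : p.1 + p.2 = d := by simpa using hp
  rw [← hp', map_add]
  exact add_le_add (hf _ (left_ne_zero_of_mul hne)) (hg _ (right_ne_zero_of_mul hne))

theorem degLE_C (r : ℝ) : DegLE 0 (MvPowerSeries.C (σ := ℕ) r) := by
  intro d hd
  rw [MvPowerSeries.coeff_C] at hd
  by_cases h : d = 0
  · simp [h]
  · simp [h] at hd

/-- The ring `Λ` of symmetric functions with real coefficients: the formal power series of bounded
degree in countably many variables that are invariant under all permutations of the variables. -/
def SymFun : Subalgebra ℝ (MvPowerSeries ℕ ℝ) where
  carrier := {f | (∃ D, DegLE D f) ∧ ∀ π : Equiv.Perm ℕ, MvPowerSeries.rename π f = f}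
  mul_mem' := by
    rintro f g ⟨⟨D, hD⟩, hf⟩ ⟨⟨D', hD'⟩, hg⟩
    exact ⟨⟨D + D', hD.mul hD'⟩, fun π => by rw [map_mul, hf, hg]⟩
  add_mem' := by
    rintro f g ⟨⟨D, hD⟩, hf⟩ ⟨⟨D', hD'⟩, hg⟩
    exact ⟨⟨max D D', (hD.mono (le_max_left _ _)).add (hD'.mono (le_max_right _ _))⟩,
      fun π => by rw [map_add, hf, hg]⟩
  algebraMap_mem' r := ⟨⟨0, degLE_C r⟩, fun π => AlgHom.commutes _ r⟩

theorem coeff_rename_perm (π : Equiv.Perm ℕ) (f : MvPowerSeries ℕ ℝ) (d : ℕ →₀ ℕ) :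
    MvPowerSeries.coeff (d.embDomain π.toEmbedding) (MvPowerSeries.rename π f) =
      MvPowerSeries.coeff d f :=
  MvPowerSeries.coeff_embDomain_rename π.toEmbedding f d

theorem mem_symFun_of {f : MvPowerSeries ℕ ℝ} {D : ℕ} (hD : DegLE D f)
    (h : ∀ (π : Equiv.Perm ℕ) (d : ℕ →₀ ℕ), MvPowerSeries.coeff (d.embDomain π.toEmbedding) f =
      MvPowerSeries.coeff d f) : f ∈ SymFun := by
  refine ⟨⟨D, hD⟩, fun π => ?_⟩
  ext d
  have hd : d = (d.embDomain π.symm.toEmbedding).embDomain π.toEmbedding := by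
    ext j
    obtain ⟨i, rfl⟩ := π.surjective j
    refine Eq.trans ?_ (Finsupp.embDomain_apply_self π.toEmbedding _ i).symm
    have h2 := Finsupp.embDomain_apply_self π.symm.toEmbedding d (π i)
    simpa using h2.symm
  have h3 := coeff_rename_perm π f (d.embDomain π.symm.toEmbedding)
  rw [← hd] at h3
  have h4 := h π (d.embDomain π.symm.toEmbedding)
  rw [← hd] at h4
  rw [h3, h4]

theorem coeff_embDomain_of_mem {f : MvPowerSeries ℕ ℝ} (hf : f ∈ SymFun) (π : Equiv.Perm ℕ)
    (d : ℕ →₀ ℕ) : MvPowerSeries.coeff (d.embDomain π.toEmbedding) f =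
      MvPowerSeries.coeff d f := by
  conv_lhs => rw [← hf.2 π]
  exact coeff_rename_perm π f d

/-- The elementary symmetric function `e_m`, as a power series: the sum of the monomials
`∏_{i ∈ S} x_i` over all `m`-element sets `S` of indices. -/
def elemSeries (m : ℕ) : MvPowerSeries ℕ ℝ :=
  fun d => if ∃ S : Finset ℕ, S.card = m ∧ d = ∑ i ∈ S, Finsupp.single i 1 then 1 else 0

theorem coeff_elemSeries (m : ℕ) (d : ℕ →₀ ℕ) : MvPowerSeries.coeff d (elemSeries m) =
    if ∃ S : Finset ℕ, S.card = m ∧ d = ∑ i ∈ S, Finsupp.single i 1 then 1 else 0 := rfl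

theorem embDomain_sum_single {α β : Type*} (e : α ↪ β) (S : Finset α) :
    (∑ i ∈ S, Finsupp.single i 1 : α →₀ ℕ).embDomain e =
      ∑ j ∈ S.map e, Finsupp.single j 1 := by
  rw [Finset.sum_map, ← Finsupp.embDomain.addMonoidHom_apply, map_sum]
  simp [Finsupp.embDomain_single]

theorem degLE_elemSeries (m : ℕ) : DegLE m (elemSeries m) := by
  intro d hd
  rw [coeff_elemSeries] at hd
  split_ifs at hd with h
  · obtain ⟨S, hS, rfl⟩ := h
    simp [map_sum, Finsupp.degree_single, hS]
  · exact absurd rfl hd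

/-- The elementary symmetric function `e_m ∈ Λ`. -/
def e (m : ℕ) : SymFun :=
  ⟨elemSeries m, mem_symFun_of (degLE_elemSeries m) (by
    intro π d
    rw [coeff_elemSeries, coeff_elemSeries]
    congr 1
    apply propext
    constructor
    · rintro ⟨S, hS, h⟩
      refine ⟨S.map π.symm.toEmbedding, by simpa using hS, ?_⟩
      apply Finsupp.embDomain_injective π.toEmbedding
      rw [h, embDomain_sum_single, Finset.map_map]
      congr 1
      ext i; simp
    · rintro ⟨S, hS, rfl⟩
      exact ⟨S.map π.toEmbedding, by simpa using hS, embDomain_sum_single _ _⟩)⟩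

/-- A partition (of any natural number): a finite multiset of positive integers, that is, a
non-increasing finite sequence of positive integers. -/
abbrev Ptn : Type := Multiset ℕ+

/-- The size `|λ|` of a partition. -/
def Ptn.size (lam : Ptn) : ℕ := (lam.map (fun i : ℕ+ => (i : ℕ))).sum

/-- The partition `2^l 1^k`. -/
def twoOne (l k : ℕ) : Ptn := Multiset.replicate l 2 + Multiset.replicate k 1

/-- The monomial symmetric function `m_λ`, as a power series: the sum of all monomials whose
nonzero exponents are, up to order, the parts of `λ`. -/
def monoSeries (lam : Ptn) : MvPowerSeries ℕ ℝ :=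
  fun d => if d.support.val.map d = lam.map (fun i : ℕ+ => (i : ℕ)) then 1 else 0

theorem coeff_monoSeries (lam : Ptn) (d : ℕ →₀ ℕ) : MvPowerSeries.coeff d (monoSeries lam) =
    if d.support.val.map d = lam.map (fun i : ℕ+ => (i : ℕ)) then 1 else 0 := rfl

/-- The monomial symmetric function `m_λ ∈ Λ`. -/
def m (lam : Ptn) : SymFun :=
  ⟨monoSeries lam, mem_symFun_of (D := lam.size) (by
    intro d hd
    rw [coeff_monoSeries] at hd
    split_ifs at hd with h
    · rw [Ptn.size, ← h]; exact le_of_eq rfl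
    · exact absurd rfl hd) (by
    intro π d
    rw [coeff_monoSeries, coeff_monoSeries]
    congr 2
    rw [Finsupp.support_embDomain, Finset.map_val, Multiset.map_map]
    refine Multiset.map_congr rfl fun i _ => ?_
    exact Finsupp.embDomain_apply_self π.toEmbedding d i)⟩

/-! ### The elementary symmetric functions freely generate `Λ` -/

/-- The algebra homomorphism from the polynomial ring in `y₁, y₂, …` to `Λ` with `y_i ↦ e_i`. -/
def elemHom : MvPolynomial ℕ+ ℝ →ₐ[ℝ] SymFun := MvPolynomial.aeval fun i : ℕ+ => e i

theorem killCompl_elemSeries (n k : ℕ) :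
    MvPowerSeries.killCompl (Fin.valEmbedding (n := n)) (elemSeries k) =
      (MvPolynomial.esymm (Fin n) ℝ k : MvPowerSeries (Fin n) ℝ) := by
  ext d
  rw [MvPowerSeries.coeff_killCompl, coeff_elemSeries, MvPolynomial.coeff_coe,
    MvPolynomial.esymm_eq_sum_monomial, MvPolynomial.coeff_sum]
  simp only [MvPolynomial.coeff_monomial]
  have hinj : ∀ S T : Finset (Fin n), (∑ i ∈ S, Finsupp.single i 1 : Fin n →₀ ℕ) =
      ∑ i ∈ T, Finsupp.single i 1 → S = T := by
    intro S T h
    ext i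
    have := DFunLike.congr_fun h i
    simp only [Finsupp.finsetSum_apply, Finsupp.single_apply, Finset.sum_ite_eq'] at this
    by_cases h1 : i ∈ S <;> by_cases h2 : i ∈ T <;> simp_all
  by_cases h : ∃ S : Finset (Fin n), S.card = k ∧ d = ∑ i ∈ S, Finsupp.single i 1
  · obtain ⟨S, hS, rfl⟩ := h
    rw [if_pos ⟨S.map Fin.valEmbedding, by simpa using hS, embDomain_sum_single _ _⟩,
      Finset.sum_eq_single S]
    · simp
    · intro T _ hT
      rw [if_neg fun h => hT (hinj _ _ h)]
    · intro h
      exact absurd (Finset.mem_powersetCard.2 ⟨Finset.subset_univ _, hS⟩) h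
  · rw [if_neg, Finset.sum_eq_zero]
    · intro T hT
      rw [if_neg]
      rintro rfl
      exact h ⟨T, (Finset.mem_powersetCard.1 hT).2, rfl⟩
    · rintro ⟨S, hS, hd⟩
      have hsub : ∀ j ∈ S, j ∈ Set.range (Fin.valEmbedding (n := n)) := by
        intro j hj
        by_contra hr
        have h0 := Finsupp.embDomain_of_notMem_range Fin.valEmbedding d j hr
        rw [hd] at h0
        simp only [Finsupp.finsetSum_apply, Finsupp.single_apply, Finset.sum_ite_eq', hj] at h0
        exact absurd h0 (by simp)
      have hS' : (S.preimage (Fin.valEmbedding (n := n))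
          (Fin.valEmbedding.injective.injOn)).map Fin.valEmbedding = S := by
        ext j
        simp only [Finset.mem_map, Finset.mem_preimage]
        constructor
        · rintro ⟨i, hi, rfl⟩; exact hi
        · intro hj
          obtain ⟨i, rfl⟩ := hsub j hj
          exact ⟨i, hj, rfl⟩
      refine h ⟨S.preimage (Fin.valEmbedding (n := n)) (Fin.valEmbedding.injective.injOn), ?_, ?_⟩
      · rw [← hS, ← Finset.card_map Fin.valEmbedding, hS']
      · apply Finsupp.embDomain_injective Fin.valEmbedding
        rw [hd, embDomain_sum_single, hS']

theorem elemHom_injective : Function.Injective elemHom := by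
  rw [injective_iff_map_eq_zero]
  intro p hp
  obtain ⟨s, q, rfl⟩ := MvPolynomial.exists_finset_rename p
  let n : ℕ := s.sup fun i => (i : ℕ)
  let g : s → Fin n := fun i => ⟨(i : ℕ+) - 1, by
    have h1 : ((i : ℕ+) : ℕ) ≤ n := Finset.le_sup (f := fun i : ℕ+ => (i : ℕ)) i.2
    have h2 := (i : ℕ+).pos
    omega⟩
  have hg : Function.Injective g := by
    intro i j hij
    have h := congrArg Fin.val hij
    simp only [g] at h
    have h1 := (i : ℕ+).pos
    have h2 := (j : ℕ+).pos
    apply Subtype.ext; apply PNat.eq; omega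
  let K : SymFun →ₐ[ℝ] MvPowerSeries (Fin n) ℝ :=
    (MvPowerSeries.killCompl (Fin.valEmbedding (n := n))).comp SymFun.val
  let J : MvPolynomial s ℝ →ₐ[ℝ] MvPowerSeries (Fin n) ℝ :=
    ((MvPolynomial.coeToMvPowerSeries.algHom ℝ).comp
      (MvPolynomial.symmetricSubalgebra (Fin n) ℝ).val).comp
      ((MvPolynomial.esymmAlgHom (Fin n) ℝ n).comp (MvPolynomial.rename g))
  have key : K.comp (elemHom.comp (MvPolynomial.rename Subtype.val)) = J := by
    apply MvPolynomial.algHom_ext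
    intro i
    have h : K (e (i : ℕ+)) =
      (MvPolynomial.esymm (Fin n) ℝ (i : ℕ+) : MvPowerSeries (Fin n) ℝ) :=
      killCompl_elemSeries n _
    have h2 := (i : ℕ+).pos
    have h3 : ((i : ℕ+) : ℕ) - 1 + 1 = (i : ℕ+) := by omega
    simp [J, elemHom, h, MvPolynomial.esymmAlgHom, g, h3]
  have hJ : J q = 0 := by
    rw [← key]
    simp [hp]
  have h1 : (MvPolynomial.esymmAlgHom (Fin n) ℝ n) (MvPolynomial.rename g q) = 0 := by
    apply Subtype.ext
    apply MvPolynomial.coe_injective (σ := Fin n) (R := ℝ)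
    simpa [J] using hJ
  have h2 : MvPolynomial.rename g q = 0 :=
    MvPolynomial.esymmAlgHom_fin_injective ℝ le_rfl (by rw [h1, map_zero])
  have h3 : q = 0 := MvPolynomial.rename_injective g hg (by rw [h2, map_zero])
  rw [h3, map_zero]

/-- The product `e_λ = ∏ e_{λ_i}`. -/
def eProd (lam : Ptn) : SymFun := (lam.map fun i : ℕ+ => e i).prod

theorem elemHom_monomial (lam : Ptn) :
    elemHom (MvPolynomial.monomial (Multiset.toFinsupp lam) 1) = eProd lam := by
  induction lam using Multiset.induction_on with
  | empty => simp [eProd]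
  | cons a s ih =>
    have : MvPolynomial.monomial (Multiset.toFinsupp (a ::ₘ s)) (1 : ℝ) =
        MvPolynomial.X a * MvPolynomial.monomial (Multiset.toFinsupp s) 1 := by
      rw [← Multiset.singleton_add, Multiset.toFinsupp_add, Multiset.toFinsupp_singleton,
        MvPolynomial.X, MvPolynomial.monomial_mul, one_mul]
    rw [this, map_mul, ih]
    simp [eProd, elemHom]

theorem eProd_linearIndependent : LinearIndependent ℝ eProd := by
  have h := ((MvPolynomial.basisMonomials ℕ+ ℝ).linearIndependent.map' elemHom.toLinearMap
    (LinearMap.ker_eq_bot.2 elemHom_injective)).comp _ (Multiset.toFinsupp (α := ℕ+)).injective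
  have heq : eProd = (elemHom.toLinearMap ∘ MvPolynomial.basisMonomials ℕ+ ℝ) ∘
      Multiset.toFinsupp := by
    funext lam
    simp [elemHom_monomial]
  rw [heq]
  exact h

theorem degLE_eProd (lam : Ptn) : DegLE lam.size (eProd lam : MvPowerSeries ℕ ℝ) := by
  induction lam using Multiset.induction_on with
  | empty =>
    have h := degLE_C 1
    simpa [eProd, Ptn.size] using h
  | cons a s ih =>
    have h := (degLE_elemSeries (a : ℕ)).mul ih
    simpa [eProd, Ptn.size, e] using h

theorem exists_perm_of_vals {d d' : ℕ →₀ ℕ} (h : d.support.val.map d = d'.support.val.map d') :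
    ∃ π : Equiv.Perm ℕ, d.embDomain π.toEmbedding = d' := by
  have hc : ∀ c : ℕ, c ≠ 0 → (d.support.filter fun i => d i = c).card =
      (d'.support.filter fun i => d' i = c).card := by
    intro c _
    have h1 := congrArg (Multiset.count c) h
    rw [Multiset.count_map, Multiset.count_map] at h1
    simpa [Finset.card, eq_comm] using h1
  let s : Finset ℕ := d.support ∪ d'.support
  have hm : ∀ c : ℕ, Nonempty ({i : s // d i = c} ≃ {i : s // d' i = c}) := by
    have aux : ∀ (f : ℕ →₀ ℕ), f.support ⊆ s → ∀ c, c ≠ 0 →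
        Fintype.card {i : s // f i = c} = (f.support.filter fun i => f i = c).card := by
      intro f hf c hc0
      rw [Fintype.card_subtype]
      refine Finset.card_bij (fun i _ => (i : ℕ)) ?_ ?_ ?_
      · intro i hi
        simp only [Finset.mem_filter, Finset.mem_univ, true_and] at hi
        simp [hi, hc0]
      · intro i _ j _ hij
        exact Subtype.ext hij
      · intro j hj
        simp only [Finset.mem_filter] at hj
        exact ⟨⟨j, hf hj.1⟩, by simp [hj.2], rfl⟩
    have hsum : ∀ (f : ℕ →₀ ℕ), f.support ⊆ s → Fintype.card {i : s // f i = 0} =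
        s.card - f.support.card := by
      intro f hf
      rw [← Finset.card_sdiff_of_subset hf, Fintype.card_subtype]
      refine Finset.card_bij (fun i _ => (i : ℕ)) ?_ ?_ ?_
      · intro i hi
        simp only [Finset.mem_filter, Finset.mem_univ, true_and] at hi
        simp [hi]
      · intro i _ j _ hij
        exact Subtype.ext hij
      · intro j hj
        simp only [Finset.mem_sdiff, Finsupp.mem_support_iff, not_not] at hj
        exact ⟨⟨j, hj.1⟩, by simp [hj.2], rfl⟩
    intro c
    refine ⟨Fintype.equivOfCardEq ?_⟩
    by_cases h0 : c = 0
    · subst h0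
      rw [hsum d Finset.subset_union_left, hsum d' Finset.subset_union_right]
      have := congrArg Multiset.card h
      simp only [Multiset.card_map] at this
      rw [Finset.card_def d.support, Finset.card_def d'.support, this]
    · rw [aux d Finset.subset_union_left c h0, aux d' Finset.subset_union_right c h0, hc c h0]
  let σ : Equiv.Perm s := (Equiv.sigmaFiberEquiv fun i : s => d i).symm.trans
    ((Equiv.sigmaCongrRight fun c => (hm c).some).trans (Equiv.sigmaFiberEquiv fun i : s => d' i))
  have hσ : ∀ i : s, d' (σ i) = d i := by
    intro i
    exact ((hm (d i)).some ⟨i, rfl⟩).2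
  refine ⟨σ.extendDomain (Equiv.refl {i : ℕ // i ∈ s}), ?_⟩
  ext j
  obtain ⟨i, rfl⟩ := (σ.extendDomain (Equiv.refl {i : ℕ // i ∈ s})).surjective j
  refine (Finsupp.embDomain_apply_self
    (σ.extendDomain (Equiv.refl {i : ℕ // i ∈ s})).toEmbedding d i).trans ?_
  by_cases hi : i ∈ s
  · rw [Equiv.Perm.extendDomain_apply_subtype _ _ hi]
    exact (hσ ⟨i, hi⟩).symm
  · rw [Equiv.Perm.extendDomain_apply_not_subtype _ _ hi]
    simp only [s, Finset.mem_union, Finsupp.mem_support_iff, not_or, not_not] at hi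
    rw [hi.1, hi.2]

theorem finite_size_le (D : ℕ) : Finite {lam : Ptn // lam.size ≤ D} := by
  let F : {lam : Ptn // lam.size ≤ D} → Σ n : Fin (D + 1), Nat.Partition n := fun lam =>
    ⟨⟨lam.1.size, Nat.lt_succ_of_le lam.2⟩,
      ⟨lam.1.map (fun i : ℕ+ => (i : ℕ)), by
        intro i hi
        obtain ⟨a, _, rfl⟩ := Multiset.mem_map.1 hi
        exact a.pos, rfl⟩⟩
  refine Finite.of_injective F fun a b hab => ?_
  have h : ∀ x y : Σ n : Fin (D + 1), Nat.Partition n, x = y → x.2.parts = y.2.parts := by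
    rintro x y rfl; rfl
  exact Subtype.ext (Multiset.map_injective PNat.coe_injective (h _ _ hab))

/-- The symmetric functions of degree at most `D`. -/
def symLE (D : ℕ) : Submodule ℝ SymFun where
  carrier := {f | DegLE D (f : MvPowerSeries ℕ ℝ)}
  add_mem' hf hg := DegLE.add hf hg
  zero_mem' := by intro d hd; simp at hd
  smul_mem' c f hf := by
    intro d hd
    refine hf d fun h => hd ?_
    simp [h]

/-- The coefficients of a symmetric function of degree at most `D` at one monomial of each type. -/
def valMap (D : ℕ) : symLE D →ₗ[ℝ] ({lam : Ptn // lam.size ≤ D} → ℝ) where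
  toFun f lam :=
    if h : ∃ d : ℕ →₀ ℕ, d.support.val.map d = lam.1.map (fun i : ℕ+ => (i : ℕ)) then
      MvPowerSeries.coeff h.choose ((f : SymFun) : MvPowerSeries ℕ ℝ) else 0
  map_add' f g := by
    ext lam
    simp only [Pi.add_apply]
    split_ifs <;> simp
  map_smul' c f := by
    ext lam
    simp only [Pi.smul_apply]
    split_ifs <;> simp

theorem valMap_injective (D : ℕ) : Function.Injective (valMap D) := by
  rw [injective_iff_map_eq_zero]
  intro f hf0
  apply Subtype.ext; apply Subtype.ext
  ext d
  by_contra hne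
  have hdeg : d.degree ≤ D := f.2 d hne
  have hpos : ∀ i ∈ d.support.val.map d, 0 < i := by
    intro i hi
    obtain ⟨j, hj, rfl⟩ := Multiset.mem_map.1 hi
    exact Nat.pos_of_ne_zero (Finsupp.mem_support_iff.1 hj)
  obtain ⟨lam, hlam⟩ : ∃ lam : Ptn, lam.map (fun i : ℕ+ => (i : ℕ)) = d.support.val.map d :=
    CanLift.prf (d.support.val.map d) hpos
  have hs : lam.size ≤ D := by
    rw [Ptn.size, hlam]; exact hdeg
  have h : ∃ d : ℕ →₀ ℕ, d.support.val.map d = lam.map (fun i : ℕ+ => (i : ℕ)) :=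
    ⟨d, hlam.symm⟩
  have h1 := congrFun hf0 ⟨lam, hs⟩
  have h2 : MvPowerSeries.coeff h.choose ((f : SymFun) : MvPowerSeries ℕ ℝ) = 0 := by
    simpa [valMap, h] using h1
  obtain ⟨π, hπ⟩ := exists_perm_of_vals (h.choose_spec.trans hlam)
  apply hne
  rw [← hπ, coeff_embDomain_of_mem f.1.2, h2]
  rfl

theorem mem_span_of_injective {ι M : Type*} [Finite ι] [AddCommGroup M] [Module ℝ M]
    (p : Submodule ℝ M) (v : ι → M) (hvp : ∀ i, v i ∈ p) (hv : LinearIndependent ℝ v)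
    (T : p →ₗ[ℝ] (ι → ℝ)) (hT : Function.Injective T) (f : M) (hf : f ∈ p) :
    f ∈ Submodule.span ℝ (Set.range v) := by
  have := Fintype.ofFinite ι
  have : FiniteDimensional ℝ p := FiniteDimensional.of_injective T hT
  let w : ι → p := fun i => ⟨v i, hvp i⟩
  have hw : LinearIndependent ℝ w := LinearIndependent.of_comp p.subtype hv
  have hcard : Fintype.card ι = Module.finrank ℝ p := by
    apply le_antisymm hw.fintype_card_le_finrank
    have := LinearMap.finrank_le_finrank_of_injective hT
    rwa [Module.finrank_fintype_fun_eq_card] at this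
  have hmem : (⟨f, hf⟩ : p) ∈ Submodule.span ℝ (Set.range w) := by
    rw [hw.span_eq_top_of_card_eq_finrank' hcard]; trivial
  have := Submodule.mem_map_of_mem (f := p.subtype) hmem
  rw [Submodule.map_span] at this
  refine Submodule.span_mono ?_ this
  rintro _ ⟨_, ⟨i, rfl⟩, rfl⟩
  exact ⟨i, rfl⟩

theorem mem_span_eProd (D : ℕ) (f : SymFun) (hf : f ∈ symLE D) :
    f ∈ Submodule.span ℝ (Set.range eProd) := by
  have := finite_size_le D
  have h := mem_span_of_injective (symLE D) (fun lam : {lam : Ptn // lam.size ≤ D} => eProd lam)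
    (fun lam => (degLE_eProd lam.1).mono lam.2)
    (eProd_linearIndependent.comp Subtype.val Subtype.val_injective) (valMap D)
    (valMap_injective D) f hf
  refine Submodule.span_mono ?_ h
  rintro _ ⟨lam, rfl⟩
  exact ⟨lam, rfl⟩

theorem span_eProd : ⊤ ≤ Submodule.span ℝ (Set.range eProd) := by
  intro f _
  obtain ⟨D, hD⟩ := f.2.1
  exact mem_span_eProd D f hD

/-- The functions `e_λ`, `λ` running over all partitions, form a basis of `Λ`. -/
def eBasis : Module.Basis Ptn ℝ SymFun := Module.Basis.mk eProd_linearIndependent span_eProd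

theorem eBasis_apply (lam : Ptn) : eBasis lam = eProd lam := by simp [eBasis]

theorem elemHom_surjective : Function.Surjective elemHom := by
  intro f
  have h : Submodule.span ℝ (Set.range eProd) ≤ LinearMap.range elemHom.toLinearMap := by
    rw [Submodule.span_le]
    rintro _ ⟨lam, rfl⟩
    exact ⟨_, elemHom_monomial lam⟩
  exact h (span_eProd trivial)

/-- `Λ` is the polynomial ring in `e₁, e₂, …`. -/
def elemEquiv : MvPolynomial ℕ+ ℝ ≃ₐ[ℝ] SymFun :=
  AlgEquiv.ofBijective elemHom ⟨elemHom_injective, elemHom_surjective⟩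

/-! ### Graphs: the chromatic symmetric function and the `G`-homomorphism -/

section Graph

variable {V : Type*} [Fintype V]

/-- The exponent of the monomial `x^c = ∏_v x_{c(v)}`. -/
def colorExp {G : SimpleGraph V} (c : G.Coloring ℕ) : ℕ →₀ ℕ := ∑ v, Finsupp.single (c v) 1

/-- The sum of the monomials `x^c` over all proper colorings `c` of `G`: the coefficient of a
monomial is the number of proper colorings `c` for which `x^c` is this monomial. -/
def chromSeries (G : SimpleGraph V) : MvPowerSeries ℕ ℝ :=
  fun d => (Nat.card {c : G.Coloring ℕ // colorExp c = d} : ℝ)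

theorem coeff_chromSeries (G : SimpleGraph V) (d : ℕ →₀ ℕ) :
    MvPowerSeries.coeff d (chromSeries G) = (Nat.card {c : G.Coloring ℕ // colorExp c = d} : ℝ) :=
  rfl

/-- Only finitely many proper colorings have a given monomial, so that the cardinality in
`chromSeries` is a genuine one. -/
theorem finite_colorings (G : SimpleGraph V) (d : ℕ →₀ ℕ) :
    Finite {c : G.Coloring ℕ // colorExp c = d} := by
  let F : {c : G.Coloring ℕ // colorExp c = d} → (V → d.support) := fun c v => ⟨c.1 v, by
    have hc : d (c.1 v) = ∑ w, (Finsupp.single (c.1 w) 1 : ℕ →₀ ℕ) (c.1 v) := by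
      rw [← Finsupp.finsetSum_apply]
      exact (DFunLike.congr_fun c.2 (c.1 v)).symm
    rw [Finsupp.mem_support_iff, hc]
    have h : (Finsupp.single (c.1 v) 1 : ℕ →₀ ℕ) (c.1 v) ≤
        ∑ w, (Finsupp.single (c.1 w) 1 : ℕ →₀ ℕ) (c.1 v) :=
      Finset.single_le_sum (f := fun w => (Finsupp.single (c.1 w) 1 : ℕ →₀ ℕ) (c.1 v))
        (fun _ _ => Nat.zero_le _) (Finset.mem_univ v)
    rw [Finsupp.single_eq_same] at h
    omega⟩
  refine Finite.of_injective F fun a b hab => ?_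
  apply Subtype.ext
  apply RelHom.ext
  intro v
  exact congrArg Subtype.val (congrFun hab v)

theorem colorExp_comp (G : SimpleGraph V) (c c' : G.Coloring ℕ) (π : ℕ ↪ ℕ)
    (h : ∀ v, c' v = π (c v)) : colorExp c' = (colorExp c).embDomain π := by
  rw [colorExp, colorExp, ← Finsupp.embDomain.addMonoidHom_apply, map_sum]
  simp [Finsupp.embDomain_single, h]

/-- Recolor a proper coloring by a permutation of the colors. -/
def recolor (G : SimpleGraph V) (π : Equiv.Perm ℕ) : G.Coloring ℕ ≃ G.Coloring ℕ where
  toFun c := SimpleGraph.Coloring.mk (fun v => π (c v)) fun h hc => c.valid h (π.injective hc)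
  invFun c := SimpleGraph.Coloring.mk (fun v => π.symm (c v))
    fun h hc => c.valid h (π.symm.injective hc)
  left_inv c := by apply RelHom.ext; intro v; exact π.symm_apply_apply _
  right_inv c := by apply RelHom.ext; intro v; exact π.apply_symm_apply _

/-- The chromatic symmetric function `X_G ∈ Λ`. -/
def chromSym (G : SimpleGraph V) : SymFun :=
  ⟨chromSeries G, mem_symFun_of (D := Fintype.card V) (by
    intro d hd
    rw [coeff_chromSeries, Nat.cast_ne_zero] at hd
    obtain ⟨⟨c, rfl⟩⟩ := (Nat.card_ne_zero.1 hd).1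
    simp [colorExp, map_sum, Finsupp.degree_single]) (by
    intro π d
    rw [coeff_chromSeries, coeff_chromSeries, Nat.cast_inj]
    refine (Nat.card_congr ((recolor G π).subtypeEquiv fun c => ?_)).symm
    rw [colorExp_comp G c (recolor G π c) π.toEmbedding fun v => rfl,
      (Finsupp.embDomain_injective π.toEmbedding).eq_iff])⟩

/-- `c_λ(G)`: the coefficient of `e_λ` in the expansion of `X_G` in the `e`-basis. -/
def eCoeff (G : SimpleGraph V) (lam : Ptn) : ℝ := eBasis.repr (chromSym G) lam

/-- The `G`-analogue `e_i^G` of the elementary symmetric polynomial: the sum of `∏_{v ∈ S} v` over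
all stable sets `S` of `i` vertices. -/
def elemG (G : SimpleGraph V) (i : ℕ) : MvPolynomial V ℝ :=
  ∑ S ∈ (Finset.univ : Finset (Finset V)) with (Finset.card S = i ∧ G.IsIndepSet (S : Set V)), ∏ v ∈ S, MvPolynomial.X v

/-- The `G`-homomorphism: the ring homomorphism on `Λ` with `e_i ↦ e_i^G` for all `i ≥ 1`. -/
def gHom (G : SimpleGraph V) : SymFun →ₐ[ℝ] MvPolynomial V ℝ :=
  (MvPolynomial.aeval fun i : ℕ+ => elemG G i).comp
    (elemEquiv.symm : SymFun →ₐ[ℝ] MvPolynomial ℕ+ ℝ)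

theorem gHom_e (G : SimpleGraph V) (i : ℕ+) : gHom G (e i) = elemG G i := by
  have h : elemEquiv (MvPolynomial.X i) = e i := by
    simp [elemEquiv, elemHom]
  simp [gHom, ← h]

theorem gHom_unique (G : SimpleGraph V) (φ : SymFun →ₐ[ℝ] MvPolynomial V ℝ)
    (h : ∀ i : ℕ+, φ (e i) = elemG G i) : φ = gHom G := by
  have h2 : φ.comp elemHom = (gHom G).comp elemHom := by
    apply MvPolynomial.algHom_ext
    intro i
    simp [elemHom, h, gHom_e]
  ext1 f
  obtain ⟨p, rfl⟩ := elemHom_surjective f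
  exact DFunLike.congr_fun h2 p

end Graph

/-! ### Unit interval orders -/

/-- A finite poset is a unit interval order if it is isomorphic to a (finite) set of real numbers
with `w ≺ u` if and only if `u ≥ w + 1`. -/
def IsUnitIntervalOrder (U : Type*) [PartialOrder U] : Prop :=
  Finite U ∧ ∃ f : U → ℝ, Function.Injective f ∧ ∀ w u : U, w < u ↔ f w + 1 ≤ f u

/-- `u ∼ w`: neither `u ≺ w` nor `w ≺ u` (in a unit interval order of real numbers, `|u - w| < 1`;
in particular `u ∼ u`). -/
def Sim {U : Type*} [PartialOrder U] (u w : U) : Prop := ¬ u < w ∧ ¬ w < u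

/-- The incomparability graph of a poset. -/
def incGraph (U : Type*) [PartialOrder U] : SimpleGraph U where
  Adj u w := ¬ u ≤ w ∧ ¬ w ≤ u
  symm := ⟨fun _ _ h => ⟨h.2, h.1⟩⟩
  loopless := ⟨fun _ h => h.1 le_rfl⟩

/-- The pairs `(ξ, ε)` of chains `ξ_1 ≺ ⋯ ≺ ξ_l` and `ε_1 ≺ ⋯ ≺ ε_{k+l}` such that there are
indices `i_1 < ⋯ < i_l` in `{1, …, k + l}` with `ξ_j ∼ ε_{i_j}` for all `j`. -/
def chainPairs (U : Type*) [Fintype U] [PartialOrder U] (l k : ℕ) :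
    Finset ((Fin l → U) × (Fin (k + l) → U)) :=
  Finset.univ.filter fun p => StrictMono p.1 ∧ StrictMono p.2 ∧
    ∃ i : Fin l → Fin (k + l), StrictMono i ∧ ∀ j, Sim (p.1 j) (p.2 (i j))

end ChromSym

end

noncomputable section

namespace ChromSym

open scoped Classical

/-! The first claim is proved by comparing two expansions of a product of two elementary functions.
In `Λ`, `e_mul_e` gives, for `b ≤ a`, `e_a e_b = ∑_j C(a+b-2j, b-j) m_{2^j,1^{a+b-2j}}`, with
coefficient `1` at `j = b`. In `ℝ[U]`, `elemSep_mul_elemSep` gives the same identity with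
`matchedSum f j (a+b-j)`, the proposed value, in place of the image of the monomial function. Taking
`b = l`, `a = k + l` and inducting on `l`, all terms with `j < l` cancel and the terms at `j = l`
must agree (`gHom_twoOne`).

The second identity is checked one monomial at a time. Fix a multiset `w` of points and consider the
pairs `(S, T)` of stable sets covering `w`. By `exists_pairGen_eq` the generating polynomial of
`|S|` is `c X^{j₀} (1+X)^{|w|-2j₀}`, and `S` can be matched into `T` along incomparable or equal
points exactly when `|S| = j₀`. So there are `c` matched pairs and `c · C(|w|-2j₀, b-j₀)` pairs with
`|S| = b ≥ j₀`. The proof removes the rightmost point of `w`. If it is near nothing else, it may go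
to either set, giving a factor `1 + X`. Otherwise it has exactly one neighbour, since three mutually
near points cannot be covered by two stable sets; the two points go to opposite sets, giving a
factor `X` and a constant. A matching between chains automatically preserves order
(`matched_image_iff`), so matched pairs are the pairs of chains in the theorem.

For positivity, `eCoeff_eq_fullCoeff` identifies `c_λ` with the coefficient of `∏_v v` in the image
of `m_λ`. This is a duality: the matrix expressing products of elementary functions in monomial ones
is symmetric, and the coefficient of `∏_v v` in the image of a product of `e_{a_i}` is the
coefficient of `x^a` in `X_G`. The first claim displays the image of `m_{2^k,1^{n-2k}}` as a sum of
monomials, so the coefficient is nonnegative. -/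

/-- The exponent vector with entries `1` on `S` and `0` elsewhere. -/
def indic {α : Type*} (S : Finset α) : α →₀ ℕ := ∑ i ∈ S, Finsupp.single i 1

theorem indic_apply {α : Type*} [DecidableEq α] (S : Finset α) (i : α) : indic S i = if i ∈ S then 1 else 0 := by
  simp [indic, Finsupp.finsetSum_apply, Finsupp.single_apply]

theorem indic_injective {α : Type*} : Function.Injective (indic : Finset α → α →₀ ℕ) := by
  intro S T h
  ext i
  have := DFunLike.congr_fun h i
  rw [indic_apply, indic_apply] at this
  by_cases h1 : i ∈ S <;> by_cases h2 : i ∈ T <;> simp_all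

theorem degree_indic {α : Type*} (S : Finset α) : (indic S).degree = S.card := by
  simp [indic, map_sum, Finsupp.degree_single]

/-! ### Products of two elementary symmetric functions -/

theorem map_support_eq_twoOne_iff (d : ℕ →₀ ℕ) (j k : ℕ) :
    d.support.val.map d = (twoOne j k).map (fun i : ℕ+ => (i : ℕ)) ↔
      ∃ D R : Finset ℕ, Disjoint D R ∧ D.card = j ∧ R.card = k ∧
        d = indic D + indic D + indic R := by
  have hrhs : (twoOne j k).map (fun i : ℕ+ => (i : ℕ)) =
      Multiset.replicate j 2 + Multiset.replicate k 1 := by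
    simp [twoOne]
  rw [hrhs]
  constructor
  · intro h
    refine ⟨d.support.filter (d · = 2), d.support.filter (d · = 1), ?_, ?_, ?_, ?_⟩
    · exact Finset.disjoint_filter.2 fun i _ h1 h2 => by omega
    · have := congrArg (Multiset.count 2) h
      rw [Multiset.count_map] at this
      simpa [Multiset.count_replicate, Finset.card, eq_comm] using this
    · have := congrArg (Multiset.count 1) h
      rw [Multiset.count_map] at this
      simpa [Multiset.count_replicate, Finset.card, eq_comm] using this
    · ext i
      simp only [Finsupp.add_apply, indic_apply, Finset.mem_filter, Finsupp.mem_support_iff]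
      by_cases hi : d i = 0
      · simp [hi]
      · have hm : d i ∈ d.support.val.map d :=
          Multiset.mem_map_of_mem _ (Finsupp.mem_support_iff.2 hi)
        rw [h, Multiset.mem_add] at hm
        rcases hm with hm | hm
        · simp [Multiset.eq_of_mem_replicate hm]
        · simp [Multiset.eq_of_mem_replicate hm]
  · rintro ⟨D, R, hDR, rfl, rfl, rfl⟩
    have hs : (indic D + indic D + indic R).support = D.disjUnion R hDR := by
      ext i
      simp [indic_apply]
      tauto
    rw [hs]
    simp only [Finset.disjUnion_val, Multiset.map_add]
    congr 1
    · refine Multiset.eq_replicate.2 ⟨by simp, ?_⟩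
      intro b hb
      obtain ⟨i, hi, rfl⟩ := Multiset.mem_map.1 hb
      have h1 : i ∈ D := hi
      have h2 : i ∉ R := Finset.disjoint_left.1 hDR h1
      simp [indic_apply, h1, h2]
    · refine Multiset.eq_replicate.2 ⟨by simp, ?_⟩
      intro b hb
      obtain ⟨i, hi, rfl⟩ := Multiset.mem_map.1 hb
      have h1 : i ∈ R := hi
      have h2 : i ∉ D := Finset.disjoint_right.1 hDR h1
      simp [indic_apply, h1, h2]

theorem coeff_elemSeries_eq (a : ℕ) (d : ℕ →₀ ℕ) : MvPowerSeries.coeff d (elemSeries a) =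
    if ∃ S : Finset ℕ, S.card = a ∧ d = indic S then 1 else 0 := rfl

theorem coeff_elemSeries_mul (a b : ℕ) (d : ℕ →₀ ℕ) :
    MvPowerSeries.coeff d (elemSeries a * elemSeries b) =
      (((Finset.HasAntidiagonal.antidiagonal d).filter fun x => (∃ S : Finset ℕ, S.card = a ∧ x.1 = indic S) ∧
        ∃ T : Finset ℕ, T.card = b ∧ x.2 = indic T).card : ℝ) := by
  rw [MvPowerSeries.coeff_mul, Finset.card_filter, Nat.cast_sum]
  refine Finset.sum_congr rfl fun x _ => ?_
  rw [coeff_elemSeries_eq, coeff_elemSeries_eq]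
  by_cases h1 : ∃ S : Finset ℕ, S.card = a ∧ x.1 = indic S
  · by_cases h2 : ∃ T : Finset ℕ, T.card = b ∧ x.2 = indic T
    · rw [if_pos h1, if_pos h2, if_pos ⟨h1, h2⟩]
      simp
    · rw [if_pos h1, if_neg h2, if_neg fun h => h2 h.2]
      simp
  · rw [if_neg h1, zero_mul, if_neg fun h => h1 h.1, Nat.cast_zero]

/-- Indices in `D` have exponent 2 and lie in both sets. Each index of `R` lies in exactly one, so a
splitting is the choice of the part `A` of `R` that joins the second set. -/
theorem card_splittings (a b : ℕ) (D R : Finset ℕ) (hDR : Disjoint D R)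
    (hab : a + b = 2 * D.card + R.card) (hD : D.card ≤ b) :
    ((Finset.HasAntidiagonal.antidiagonal (indic D + indic D + indic R)).filter fun x =>
      (∃ S : Finset ℕ, S.card = a ∧ x.1 = indic S) ∧
        ∃ T : Finset ℕ, T.card = b ∧ x.2 = indic T).card = R.card.choose (b - D.card) := by
  rw [← Finset.card_powersetCard]
  symm
  have hdis : ∀ A ⊆ R, Disjoint D A := fun A hA => hDR.mono_right hA
  refine Finset.card_bij (fun A _ => (indic (D ∪ (R \ A)), indic (D ∪ A))) ?_ ?_ ?_
  · intro A hA
    obtain ⟨hA, hc⟩ := Finset.mem_powersetCard.1 hA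
    rw [Finset.mem_filter, Finset.HasAntidiagonal.mem_antidiagonal]
    refine ⟨?_, ⟨_, ?_, rfl⟩, ⟨_, ?_, rfl⟩⟩
    · ext i
      have h1 : i ∈ D → i ∉ R := fun h => Finset.disjoint_left.1 hDR h
      have h2 : i ∈ A → i ∈ R := fun h => hA h
      simp only [Finsupp.add_apply, indic_apply, Finset.mem_union, Finset.mem_sdiff]
      by_cases hi1 : i ∈ D <;> by_cases hi2 : i ∈ R <;> by_cases hi3 : i ∈ A <;> simp_all
    · rw [Finset.card_union_of_disjoint (hdis _ Finset.sdiff_subset),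
        Finset.card_sdiff_of_subset hA]
      have := Finset.card_le_card hA
      omega
    · rw [Finset.card_union_of_disjoint (hdis _ hA)]
      omega
  · intro A hA B hB h
    have h' := indic_injective (congrArg Prod.snd h)
    have hA' := hdis A (Finset.mem_powersetCard.1 hA).1
    have hB' := hdis B (Finset.mem_powersetCard.1 hB).1
    rw [← Finset.union_sdiff_cancel_left hA', h', Finset.union_sdiff_cancel_left hB']
  · rintro ⟨x, y⟩ hx
    rw [Finset.mem_filter, Finset.HasAntidiagonal.mem_antidiagonal] at hx
    obtain ⟨h, ⟨S, hS, rfl⟩, ⟨T, hT, rfl⟩⟩ := hx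
    simp only at h
    have key : ∀ i, (i ∈ S ↔ i ∈ D ∪ (R \ (T \ D))) ∧ (i ∈ T ↔ i ∈ D ∪ (T \ D)) ∧
        (i ∈ T \ D → i ∈ R) ∧ (i ∈ D → i ∈ T) := by
      intro i
      have hi := DFunLike.congr_fun h i
      have h1 : i ∈ D → i ∉ R := fun h => Finset.disjoint_left.1 hDR h
      simp only [Finsupp.add_apply, indic_apply] at hi
      simp only [Finset.mem_union, Finset.mem_sdiff]
      by_cases hi1 : i ∈ D <;> by_cases hi2 : i ∈ R <;> by_cases hi3 : i ∈ S <;>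
        by_cases hi4 : i ∈ T <;> simp_all
    refine ⟨T \ D, ?_, ?_⟩
    · rw [Finset.mem_powersetCard]
      refine ⟨fun i hi => (key i).2.2.1 hi, ?_⟩
      rw [Finset.card_sdiff_of_subset fun i hi => (key i).2.2.2 hi, hT]
    · have h1 : D ∪ (R \ (T \ D)) = S := by ext i; exact (key i).1.symm
      have h2 : D ∪ (T \ D) = T := by ext i; exact (key i).2.1.symm
      rw [h1, h2]

theorem exists_splitting {a b : ℕ} {d : ℕ →₀ ℕ} {S T : Finset ℕ} (hS : S.card = a)
    (hT : T.card = b) (h : indic S + indic T = d) :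
    ∃ D R : Finset ℕ, Disjoint D R ∧ D.card ≤ b ∧ a + b = 2 * D.card + R.card ∧
      d = indic D + indic D + indic R := by
  have hd : d = indic (S ∩ T) + indic (S ∩ T) + indic ((S ∪ T) \ (S ∩ T)) := by
    rw [← h]
    ext i
    simp only [Finsupp.add_apply, indic_apply, Finset.mem_inter, Finset.mem_union,
      Finset.mem_sdiff]
    by_cases h1 : i ∈ S <;> by_cases h2 : i ∈ T <;> simp_all
  refine ⟨S ∩ T, (S ∪ T) \ (S ∩ T), Finset.disjoint_sdiff, ?_, ?_, hd⟩
  · rw [← hT]; exact Finset.card_le_card Finset.inter_subset_right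
  · have := congrArg Finsupp.degree (h.trans hd)
    simp only [map_add, degree_indic] at this
    omega

/-- The expansion of `e_a e_b`, `b ≤ a`, in monomial symmetric functions. -/
theorem e_mul_e (a b : ℕ) (hba : b ≤ a) : e a * e b =
    ∑ j ∈ Finset.range (b + 1), ((a + b - 2 * j).choose (b - j) : ℝ) •
      m (twoOne j (a + b - 2 * j)) := by
  apply Subtype.ext
  ext d
  have hL : ((e a * e b : SymFun) : MvPowerSeries ℕ ℝ) = elemSeries a * elemSeries b := rfl
  rw [hL, coeff_elemSeries_mul]
  have hR : MvPowerSeries.coeff d ((∑ j ∈ Finset.range (b + 1),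
      ((a + b - 2 * j).choose (b - j) : ℝ) • m (twoOne j (a + b - 2 * j)) : SymFun) :
        MvPowerSeries ℕ ℝ) = ∑ j ∈ Finset.range (b + 1), ((a + b - 2 * j).choose (b - j) : ℝ) *
        (if d.support.val.map d = (twoOne j (a + b - 2 * j)).map (fun i : ℕ+ => (i : ℕ))
          then 1 else 0) := by
    rw [AddSubmonoidClass.coe_finsetSum, map_sum]
    refine Finset.sum_congr rfl fun j _ => ?_
    rw [← coeff_monoSeries]
    rfl
  rw [hR]
  by_cases hd : ∃ D R : Finset ℕ, Disjoint D R ∧ D.card ≤ b ∧ a + b = 2 * D.card + R.card ∧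
      d = indic D + indic D + indic R
  · obtain ⟨D, R, hDR, hD, hab, rfl⟩ := hd
    -- The number of exponents equal to 2 determines the type, so only `j = |D|` contributes.
    rw [card_splittings a b D R hDR hab hD, Finset.sum_eq_single D.card]
    · rw [if_pos, mul_one]
      · congr 2; omega
      · rw [map_support_eq_twoOne_iff]
        exact ⟨D, R, hDR, rfl, by omega, rfl⟩
    · intro j _ hj
      rw [if_neg, mul_zero]
      intro h
      have h' := (map_support_eq_twoOne_iff _ D.card R.card).2 ⟨D, R, hDR, rfl, rfl, rfl⟩
      have h2 := congrArg (Multiset.count 2) (h.symm.trans h')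
      apply hj
      simpa [twoOne, Multiset.count_replicate] using h2
    · intro h
      exact absurd (Finset.mem_range.2 (by omega)) h
  · rw [Finset.sum_eq_zero, Nat.cast_eq_zero, Finset.card_eq_zero, Finset.filter_eq_empty_iff]
    · rintro ⟨x, y⟩ hx ⟨⟨S, hS, h1⟩, T, hT, h2⟩
      rw [Finset.HasAntidiagonal.mem_antidiagonal] at hx
      simp only at hx h1 h2
      subst h1 h2
      exact hd (exists_splitting hS hT hx)
    · intro j hj
      rw [if_neg, mul_zero]
      rw [map_support_eq_twoOne_iff]
      rintro ⟨D, R, hDR, h1, h2, h3⟩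
      have := Finset.mem_range.1 hj
      exact hd ⟨D, R, hDR, by omega, by omega, h3⟩

theorem e_zero : e 0 = 1 := by
  apply Subtype.ext
  ext d
  change MvPowerSeries.coeff d (elemSeries 0) = MvPowerSeries.coeff d 1
  rw [coeff_elemSeries, MvPowerSeries.coeff_one]
  congr 1
  simp

/-! ### Near points, separated sets and matchings on the real line -/

section Pairs

variable {α : Type*} (f : α → ℝ)

/-- The points `u` and `v`, placed on the real line by `f`, are at distance less than `1`. -/
def Near (u v : α) : Prop := f u < f v + 1 ∧ f v < f u + 1

variable {f}

theorem near_refl (u : α) : Near f u u := ⟨by linarith, by linarith⟩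

theorem Near.symm {u v : α} (h : Near f u v) : Near f v u := ⟨h.2, h.1⟩

/-- Both points lie in the half-open unit interval ending at `x`. Hence the neighbours of a
rightmost point are mutually near; this is where the unit length of the intervals enters. -/
theorem Near.of_le {x u v : α} (hu : Near f u x) (hv : Near f v x) (hux : f u ≤ f x)
    (hvx : f v ≤ f x) : Near f u v :=
  ⟨by linarith [hv.2], by linarith [hu.2]⟩

variable (f)

/-- The points of `S` are at distance at least `1` from one another. -/
def Separated (S : Finset α) : Prop := ∀ u ∈ S, ∀ v ∈ S, Near f u v → u = v

/-- `p` is a pair of separated sets which together cover the multiset `w`. -/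
def IsPair (w : Multiset α) (p : Finset α × Finset α) : Prop :=
  Separated f p.1 ∧ Separated f p.2 ∧ p.1.val + p.2.val = w

/-- The set `S` can be matched into the set `T` along pairs of near points. -/
def Matched (S T : Finset α) : Prop :=
  ∃ g : α → α, Set.InjOn g S ∧ ∀ u ∈ S, g u ∈ T ∧ Near f u (g u)

variable {f}

theorem Separated.mono {S T : Finset α} (hT : Separated f T) (h : S ⊆ T) : Separated f S :=
  fun u hu v hv => hT u (h hu) v (h hv)

theorem separated_insert {S : Finset α} {x : α} (hx : x ∉ S) :
    Separated f (insert x S) ↔ Separated f S ∧ ∀ v ∈ S, ¬ Near f x v := by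
  constructor
  · intro h
    refine ⟨h.mono (Finset.subset_insert _ _), fun v hv hn => hx ?_⟩
    rw [h x (Finset.mem_insert_self _ _) v (Finset.mem_insert_of_mem hv) hn]
    exact hv
  · rintro ⟨h1, h2⟩ u hu v hv hn
    rcases Finset.mem_insert.1 hu with rfl | hu
    · rcases Finset.mem_insert.1 hv with rfl | hv
      · rfl
      · exact absurd hn (h2 v hv)
    · rcases Finset.mem_insert.1 hv with h | hv
      · exact absurd (h ▸ hn).symm (h2 u hu)
      · exact h1 u hu v hv hn

theorem IsPair.mem {w : Multiset α} {p : Finset α × Finset α} (h : IsPair f w p) {u : α} :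
    u ∈ w ↔ u ∈ p.1 ∨ u ∈ p.2 := by
  rw [← h.2.2, Multiset.mem_add]; rfl

theorem IsPair.card {w : Multiset α} {p : Finset α × Finset α} (h : IsPair f w p) :
    p.1.card + p.2.card = w.card := by
  rw [← h.2.2, Multiset.card_add]; rfl

theorem IsPair.count {w : Multiset α} {p : Finset α × Finset α} (h : IsPair f w p) (u : α) :
    w.count u = (if u ∈ p.1 then 1 else 0) + if u ∈ p.2 then 1 else 0 := by
  rw [← h.2.2, Multiset.count_add, Multiset.count_eq_of_nodup p.1.nodup,
    Multiset.count_eq_of_nodup p.2.nodup]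
  rfl

theorem Separated.card_le_one {S : Finset α} (hS : Separated f S) {C : Multiset α}
    (hC : C ≤ S.val) (hn : ∀ u ∈ C, ∀ v ∈ C, Near f u v) : C.card ≤ 1 := by
  have hnd : C.Nodup := Multiset.nodup_of_le hC S.nodup
  have h : (⟨C, hnd⟩ : Finset α).card ≤ 1 := by
    rw [Finset.card_le_one]
    intro u hu v hv
    exact hS u (Multiset.mem_of_le hC hu) v (Multiset.mem_of_le hC hv) (hn u hu v hv)
  exact h

/-- A separated set contains at most one of several mutually near points, so two such sets cover at
most two of them, counted with multiplicity. -/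
theorem IsPair.card_le_two {w : Multiset α} {p : Finset α × Finset α} (h : IsPair f w p)
    {C : Multiset α} (hC : C ≤ w) (hn : ∀ u ∈ C, ∀ v ∈ C, Near f u v) : C.card ≤ 2 := by
  have h1 : (C ∩ p.1.val).card ≤ 1 := h.1.card_le_one Multiset.inter_le_right
    fun u hu v hv => hn u (Multiset.mem_of_le Multiset.inter_le_left hu) v
      (Multiset.mem_of_le Multiset.inter_le_left hv)
  have h2 : (C - p.1.val).card ≤ 1 := by
    refine h.2.1.card_le_one ?_ fun u hu v hv =>
      hn u (Multiset.mem_of_le tsub_le_self hu) v (Multiset.mem_of_le tsub_le_self hv)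
    rw [tsub_le_iff_left, h.2.2]
    exact hC
  have h3 := congrArg Multiset.card (Multiset.sub_add_inter C p.1.val)
  rw [Multiset.card_add] at h3
  omega

theorem isPair_insert_insert {w : Multiset α} {S T : Finset α} {x y : α} (hx : x ∉ S)
    (hy : y ∉ T) : IsPair f (x ::ₘ y ::ₘ w) (insert x S, insert y T) ↔
      IsPair f w (S, T) ∧ (∀ v ∈ S, ¬ Near f x v) ∧ ∀ v ∈ T, ¬ Near f y v := by
  have h : (insert x S).val + (insert y T).val = x ::ₘ y ::ₘ (S.val + T.val) := by
    rw [Finset.insert_val_of_notMem hx, Finset.insert_val_of_notMem hy, Multiset.cons_add,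
      Multiset.add_cons]
  simp only [IsPair, separated_insert hx, separated_insert hy, h, Multiset.cons_inj_right]
  tauto

theorem isPair_insert_left {w : Multiset α} {S T : Finset α} {x : α} (hx : x ∉ S) :
    IsPair f (x ::ₘ w) (insert x S, T) ↔ IsPair f w (S, T) ∧ ∀ v ∈ S, ¬ Near f x v := by
  have h : (insert x S).val + T.val = x ::ₘ (S.val + T.val) := by
    rw [Finset.insert_val_of_notMem hx, Multiset.cons_add]
  simp only [IsPair, separated_insert hx, h, Multiset.cons_inj_right]
  tauto

theorem isPair_insert_right {w : Multiset α} {S T : Finset α} {x : α} (hx : x ∉ T) :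
    IsPair f (x ::ₘ w) (S, insert x T) ↔ IsPair f w (S, T) ∧ ∀ v ∈ T, ¬ Near f x v := by
  have h : S.val + (insert x T).val = x ::ₘ (S.val + T.val) := by
    rw [Finset.insert_val_of_notMem hx, Multiset.add_cons]
  simp only [IsPair, separated_insert hx, h, Multiset.cons_inj_right]
  tauto

/-! ### Matchings and the removal of the largest points -/

theorem Matched.insert_insert {S T : Finset α} {x y : α} (h : Matched f S T) (hx : x ∉ S)
    (hy : y ∉ T) (hxy : Near f x y) : Matched f (insert x S) (insert y T) := by
  obtain ⟨g, hg, hgT⟩ := h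
  have hne : ∀ u ∈ S, u ≠ x := fun u hu h => hx (h ▸ hu)
  refine ⟨Function.update g x y, ?_, ?_⟩
  · intro u hu v hv huv
    rcases Finset.mem_insert.1 hu with rfl | hu' <;> rcases Finset.mem_insert.1 hv with rfl | hv'
    · rfl
    · rw [Function.update_self, Function.update_of_ne (hne v hv')] at huv
      exact absurd (huv ▸ (hgT v hv').1) hy
    · rw [Function.update_self, Function.update_of_ne (hne u hu')] at huv
      exact absurd (huv ▸ (hgT u hu').1) hy
    · rw [Function.update_of_ne (hne u hu'), Function.update_of_ne (hne v hv')] at huv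
      exact hg hu' hv' huv
  · intro u hu
    rcases Finset.mem_insert.1 hu with rfl | hu'
    · rw [Function.update_self]
      exact ⟨Finset.mem_insert_self _ _, hxy⟩
    · rw [Function.update_of_ne (hne u hu')]
      exact ⟨Finset.mem_insert_of_mem (hgT u hu').1, (hgT u hu').2⟩

/-- The only possible partner of `x` is `y`, so by injectivity no point of `S` uses `y`. -/
theorem Matched.of_insert_left {S T : Finset α} {x y : α}
    (h : Matched f (insert x S) (insert y T)) (hx : x ∉ S) (hT : ∀ v ∈ T, ¬ Near f x v) :
    Matched f S T := by
  obtain ⟨g, hg, hgT⟩ := h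
  have hgx : g x = y := by
    have := hgT x (Finset.mem_insert_self _ _)
    rcases Finset.mem_insert.1 this.1 with h | h
    · exact h
    · exact absurd this.2 (hT _ h)
  refine ⟨g, hg.mono (by simp), fun u hu => ?_⟩
  have := hgT u (Finset.mem_insert_of_mem hu)
  refine ⟨?_, this.2⟩
  rcases Finset.mem_insert.1 this.1 with h | h
  · have h2 := hg (Finset.mem_coe.2 (Finset.mem_insert_of_mem hu))
      (Finset.mem_coe.2 (Finset.mem_insert_self x S)) (h.trans hgx.symm)
    exact absurd (h2 ▸ hu) hx
  · exact h

/-- No point of `S` can have `x` as its partner, so the restriction of the matching to `S` avoids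
it. -/
theorem Matched.of_insert_right {S S' T : Finset α} {x : α}
    (h : Matched f S' (insert x T)) (hSS' : S ⊆ S') (hS : ∀ v ∈ S, ¬ Near f x v) :
    Matched f S T := by
  obtain ⟨g, hg, hgT⟩ := h
  refine ⟨g, hg.mono (by exact_mod_cast hSS'), fun u hu => ?_⟩
  have := hgT u (hSS' hu)
  refine ⟨?_, this.2⟩
  rcases Finset.mem_insert.1 this.1 with h | h
  · exact absurd (h ▸ this.2).symm (hS u hu)
  · exact h

theorem Matched.mono_right {S T T' : Finset α} (h : Matched f S T) (hT : T ⊆ T') :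
    Matched f S T' := by
  obtain ⟨g, hg, hgT⟩ := h
  exact ⟨g, hg, fun u hu => ⟨hT (hgT u hu).1, (hgT u hu).2⟩⟩

theorem not_matched_of_isolated {S T : Finset α} {x : α} (hx : x ∈ S)
    (hT : ∀ v ∈ T, ¬ Near f x v) : ¬ Matched f S T := by
  rintro ⟨g, _, hgT⟩
  exact hT _ (hgT x hx).1 (hgT x hx).2

end Pairs

/-! ### Counting the pairs of separated sets that cover a multiset -/

section Count

variable {α : Type*} [Fintype α] (f : α → ℝ)

/-- The pairs of separated sets covering `w`. -/
def pairs (w : Multiset α) : Finset (Finset α × Finset α) := Finset.univ.filter (IsPair f w)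

/-- The generating polynomial of the pairs covering `w` by the size of the first set. -/
def pairGen (w : Multiset α) : Polynomial ℕ := ∑ p ∈ pairs f w, Polynomial.X ^ p.1.card

variable {f}

theorem mem_pairs {w : Multiset α} {p : Finset α × Finset α} : p ∈ pairs f w ↔ IsPair f w p := by
  simp [pairs]

/-- Deleting `x` from the first set and `y` from the second is a bijection; the condition on the
right says when they can be put back. The case `x = y` is included and serves for doubled points. -/
theorem sum_pairs_cons_cons {w : Multiset α} {x y : α} (hx : x ∉ w) (hy : y ∉ w) :
    ∑ p ∈ pairs f (x ::ₘ y ::ₘ w) with x ∈ p.1 ∧ y ∈ p.2, (Polynomial.X : Polynomial ℕ) ^ p.1.card =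
      Polynomial.X * ∑ p ∈ pairs f w with (∀ v ∈ p.1, ¬ Near f x v) ∧ ∀ v ∈ p.2, ¬ Near f y v,
        Polynomial.X ^ p.1.card := by
  rw [Finset.mul_sum]
  symm
  refine Finset.sum_bij' (fun p _ => (insert x p.1, insert y p.2))
    (fun p _ => (p.1.erase x, p.2.erase y)) ?_ ?_ ?_ ?_ ?_
  · rintro ⟨S, T⟩ hp
    rw [Finset.mem_filter, mem_pairs] at hp ⊢
    have hxS : x ∉ S := fun h => hx (hp.1.mem.2 (Or.inl h))
    have hyT : y ∉ T := fun h => hy (hp.1.mem.2 (Or.inr h))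
    exact ⟨(isPair_insert_insert hxS hyT).2 hp, by simp⟩
  · rintro ⟨S, T⟩ hp
    rw [Finset.mem_filter, mem_pairs] at hp ⊢
    obtain ⟨h, h1, h2⟩ := hp
    rw [← Finset.insert_erase (show x ∈ S from h1), ← Finset.insert_erase (show y ∈ T from h2)] at h
    exact (isPair_insert_insert (Finset.notMem_erase _ _) (Finset.notMem_erase _ _)).1 h
  · rintro ⟨S, T⟩ hp
    rw [Finset.mem_filter, mem_pairs] at hp
    have hxS : x ∉ S := fun h => hx (hp.1.mem.2 (Or.inl h))
    have hyT : y ∉ T := fun h => hy (hp.1.mem.2 (Or.inr h))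
    simp [Finset.erase_insert hxS, Finset.erase_insert hyT]
  · rintro ⟨S, T⟩ hp
    rw [Finset.mem_filter] at hp
    simp [Finset.insert_erase hp.2.1, Finset.insert_erase hp.2.2]
  · rintro ⟨S, T⟩ hp
    rw [Finset.mem_filter, mem_pairs] at hp
    have hxS : x ∉ S := fun h => hx (hp.1.mem.2 (Or.inl h))
    simp [Finset.card_insert_of_notMem hxS, pow_succ']

theorem sum_pairs_cons_left {w : Multiset α} {x : α} (hx : ∀ v ∈ w, ¬ Near f x v) :
    ∑ p ∈ pairs f (x ::ₘ w) with x ∈ p.1, (Polynomial.X : Polynomial ℕ) ^ p.1.card =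
      Polynomial.X * pairGen f w := by
  rw [pairGen, Finset.mul_sum]
  have hxw : x ∉ w := fun h => hx x h (near_refl x)
  symm
  refine Finset.sum_bij' (fun p _ => (insert x p.1, p.2))
    (fun p _ => (p.1.erase x, p.2)) ?_ ?_ ?_ ?_ ?_
  · rintro ⟨S, T⟩ hp
    rw [mem_pairs] at hp
    rw [Finset.mem_filter, mem_pairs]
    have hxS : x ∉ S := fun h => hxw (hp.mem.2 (Or.inl h))
    exact ⟨(isPair_insert_left hxS).2 ⟨hp, fun v hv => hx v (hp.mem.2 (Or.inl hv))⟩, by simp⟩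
  · rintro ⟨S, T⟩ hp
    rw [Finset.mem_filter, mem_pairs] at hp
    rw [mem_pairs]
    obtain ⟨h, h1⟩ := hp
    rw [← Finset.insert_erase (show x ∈ S from h1)] at h
    exact ((isPair_insert_left (Finset.notMem_erase _ _)).1 h).1
  · rintro ⟨S, T⟩ hp
    rw [mem_pairs] at hp
    have hxS : x ∉ S := fun h => hxw (hp.mem.2 (Or.inl h))
    simp [Finset.erase_insert hxS]
  · rintro ⟨S, T⟩ hp
    rw [Finset.mem_filter] at hp
    simp [Finset.insert_erase hp.2]
  · rintro ⟨S, T⟩ hp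
    rw [mem_pairs] at hp
    have hxS : x ∉ S := fun h => hxw (hp.mem.2 (Or.inl h))
    simp [Finset.card_insert_of_notMem hxS, pow_succ']

theorem sum_pairs_cons_right {w : Multiset α} {x : α} (hx : ∀ v ∈ w, ¬ Near f x v) :
    ∑ p ∈ pairs f (x ::ₘ w) with x ∉ p.1, (Polynomial.X : Polynomial ℕ) ^ p.1.card =
      pairGen f w := by
  rw [pairGen]
  have hxw : x ∉ w := fun h => hx x h (near_refl x)
  have hmem : ∀ p ∈ (pairs f (x ::ₘ w)).filter (fun p => x ∉ p.1), x ∈ p.2 := by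
    intro p hp
    rw [Finset.mem_filter, mem_pairs] at hp
    exact (hp.1.mem.1 (Multiset.mem_cons_self _ _)).resolve_left hp.2
  symm
  refine Finset.sum_bij' (fun p _ => (p.1, insert x p.2))
    (fun p _ => (p.1, p.2.erase x)) ?_ ?_ ?_ ?_ ?_
  · rintro ⟨S, T⟩ hp
    rw [mem_pairs] at hp
    rw [Finset.mem_filter, mem_pairs]
    have hxS : x ∉ S := fun h => hxw (hp.mem.2 (Or.inl h))
    have hxT : x ∉ T := fun h => hxw (hp.mem.2 (Or.inr h))
    exact ⟨(isPair_insert_right hxT).2 ⟨hp, fun v hv => hx v (hp.mem.2 (Or.inr hv))⟩, hxS⟩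
  · rintro ⟨S, T⟩ hp
    have h1 := hmem _ hp
    rw [Finset.mem_filter, mem_pairs] at hp
    rw [mem_pairs]
    have h := hp.1
    rw [← Finset.insert_erase (show x ∈ T from h1)] at h
    exact ((isPair_insert_right (Finset.notMem_erase _ _)).1 h).1
  · rintro ⟨S, T⟩ hp
    rw [mem_pairs] at hp
    have hxT : x ∉ T := fun h => hxw (hp.mem.2 (Or.inr h))
    simp [Finset.erase_insert hxT]
  · rintro ⟨S, T⟩ hp
    simp [Finset.insert_erase (hmem _ hp)]
  · rintro ⟨S, T⟩ hp
    rfl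

theorem pairGen_cons_of_isolated {w : Multiset α} {x : α} (hx : ∀ v ∈ w, ¬ Near f x v) :
    pairGen f (x ::ₘ w) = (1 + Polynomial.X) * pairGen f w := by
  rw [pairGen, ← Finset.sum_filter_add_sum_filter_not _ (fun p => x ∈ p.1),
    sum_pairs_cons_left hx, sum_pairs_cons_right hx]
  ring

/-- Two distinct near points lie in opposite sets; the two summands are the two ways to distribute
them. -/
theorem pairGen_cons_cons_of_ne {w : Multiset α} {x y : α} (hne : y ≠ x) (hxy : Near f x y)
    (hx : x ∉ w) (hy : y ∉ w) : pairGen f (x ::ₘ y ::ₘ w) =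
      Polynomial.X * (∑ p ∈ pairs f w with (∀ v ∈ p.1, ¬ Near f x v) ∧ ∀ v ∈ p.2, ¬ Near f y v,
        Polynomial.X ^ p.1.card) +
      Polynomial.X * ∑ p ∈ pairs f w with (∀ v ∈ p.1, ¬ Near f y v) ∧ ∀ v ∈ p.2, ¬ Near f x v,
        Polynomial.X ^ p.1.card := by
  rw [← sum_pairs_cons_cons hx hy, ← sum_pairs_cons_cons hy hx, Multiset.cons_swap y x, pairGen,
    ← Finset.sum_filter_add_sum_filter_not _ (fun p => x ∈ p.1 ∧ y ∈ p.2)]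
  congr 2
  refine Finset.filter_congr fun p hp => ?_
  rw [mem_pairs] at hp
  have hcx := hp.count x
  have hcy := hp.count y
  rw [Multiset.count_cons_self, Multiset.count_cons_of_ne (Ne.symm hne),
    Multiset.count_eq_zero.2 hx] at hcx
  rw [Multiset.count_cons_of_ne hne, Multiset.count_cons_self,
    Multiset.count_eq_zero.2 hy] at hcy
  have h1 : x ∈ p.1 → y ∉ p.1 := fun h h' => hne (hp.1 y h' x h hxy.symm)
  have h2 : x ∈ p.2 → y ∉ p.2 := fun h h' => hne (hp.2.1 y h' x h hxy.symm)
  by_cases hx1 : x ∈ p.1 <;> by_cases hx2 : x ∈ p.2 <;> by_cases hy1 : y ∈ p.1 <;>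
    by_cases hy2 : y ∈ p.2 <;> simp_all

/-- Removing two near points, the larger of which is near to no further point. -/
theorem pairGen_cons_cons {w : Multiset α} {x y : α} (hxy : Near f x y)
    (hx : ∀ v ∈ w, ¬ Near f x v) (hy : ∀ v ∈ w, f v < f y)
    {p₀ : Finset α × Finset α} (h₀ : IsPair f (x ::ₘ y ::ₘ w) p₀) :
    ∃ κ : ℕ, pairGen f (x ::ₘ y ::ₘ w) = Polynomial.C κ * (Polynomial.X * pairGen f w) := by
  have hxw : x ∉ w := fun h => hx x h (near_refl x)
  have hyw : y ∉ w := fun h => hx y h hxy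
  by_cases hz : ∃ z ∈ w, Near f y z
  · obtain ⟨z, hzw, hyz⟩ := hz
    have hne : y ≠ x := by
      rintro rfl
      exact hx z hzw hyz
    -- The point `z` turns out to be the only remaining neighbour of `y`, with multiplicity one. Its
    -- position forces that of `y`, and then that of `x`, so each pair covering `w` extends in
    -- exactly one way.
    refine ⟨1, ?_⟩
    have huniq : ∀ v ∈ w.erase z, ¬ Near f y v := by
      intro v hv hn
      have hle : y ::ₘ z ::ₘ {v} ≤ x ::ₘ y ::ₘ w := by
        refine le_trans ?_ (Multiset.le_cons_self _ _)
        refine Multiset.cons_le_cons _ ?_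
        rw [← Multiset.cons_erase hzw]
        exact Multiset.cons_le_cons _ (Multiset.singleton_le.2 hv)
      have hfz := hy z hzw
      have hfv := hy v (Multiset.mem_of_mem_erase hv)
      have hzv : Near f z v := Near.of_le hyz.symm hn.symm hfz.le hfv.le
      have := h₀.card_le_two hle (by
        intro a ha b hb
        simp only [Multiset.mem_cons, Multiset.mem_singleton] at ha hb
        rcases ha with rfl | rfl | rfl <;> rcases hb with rfl | rfl | rfl <;>
          first | exact near_refl _ | assumption | (apply Near.symm; assumption))
      simp at this
    have hz1 : w.count z = 1 := by
      have h1 : 0 < w.count z := Multiset.count_pos.2 hzw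
      have h2 : (w.erase z).count z = 0 := Multiset.count_eq_zero.2 fun h => huniq z h hyz
      rw [Multiset.count_erase_self] at h2
      omega
    have hzonly : ∀ v ∈ w, Near f y v → v = z := by
      intro v hv hn
      by_contra hvz
      exact huniq v ((Multiset.mem_erase_of_ne hvz).2 hv) hn
    have hfarx : ∀ p ∈ pairs f w, (∀ v ∈ p.1, ¬ Near f x v) ∧ ∀ v ∈ p.2, ¬ Near f x v := by
      intro p hp
      rw [mem_pairs] at hp
      exact ⟨fun v hv => hx v (hp.mem.2 (Or.inl hv)), fun v hv => hx v (hp.mem.2 (Or.inr hv))⟩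
    have hex : ∀ p ∈ pairs f w, (z ∈ p.1 ↔ z ∉ p.2) := by
      intro p hp
      rw [mem_pairs] at hp
      have := hp.count z
      rw [hz1] at this
      constructor
      · intro h1 h2
        rw [if_pos h1, if_pos h2] at this
        omega
      · intro h2
        by_contra h1
        rw [if_neg h1, if_neg h2] at this
        omega
    have hfar : ∀ p ∈ pairs f w, ((∀ v ∈ p.1, ¬ Near f y v) ↔ z ∉ p.1) ∧
        ((∀ v ∈ p.2, ¬ Near f y v) ↔ z ∉ p.2) := by
      intro p hp
      rw [mem_pairs] at hp
      refine ⟨⟨fun h hz => h z hz hyz, fun h v hv hn => ?_⟩,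
        ⟨fun h hz => h z hz hyz, fun h v hv hn => ?_⟩⟩
      · exact h (hzonly v (hp.mem.2 (Or.inl hv)) hn ▸ hv)
      · exact h (hzonly v (hp.mem.2 (Or.inr hv)) hn ▸ hv)
    rw [pairGen_cons_cons_of_ne hne hxy hxw hyw, map_one, one_mul, ← mul_add, pairGen,
      ← Finset.sum_filter_add_sum_filter_not (pairs f w) (fun p => z ∈ p.1)]
    -- Placing `y` in the second set requires `z` in the first, and conversely; the two summands
    -- therefore split the pairs of `w` according to whether `z ∈ p.1`.
    congr 3
    · refine Finset.filter_congr fun p hp => ?_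
      rw [(hfar p hp).2, hex p hp]
      exact and_iff_right (hfarx p hp).1
    · refine Finset.filter_congr fun p hp => ?_
      rw [(hfar p hp).1]
      exact and_iff_left (hfarx p hp).2
  · push Not at hz
    have hfar : ∀ u, (∀ v ∈ w, ¬ Near f u v) → ∀ p ∈ pairs f w,
        (∀ v ∈ p.1, ¬ Near f u v) ∧ ∀ v ∈ p.2, ¬ Near f u v := by
      intro u hu p hp
      rw [mem_pairs] at hp
      exact ⟨fun v hv => hu v (hp.mem.2 (Or.inl hv)), fun v hv => hu v (hp.mem.2 (Or.inr hv))⟩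
    by_cases hne : y = x
    · subst hne
      -- A doubled point must lie in both sets, so there is a single extension.
      refine ⟨1, ?_⟩
      have h1 := sum_pairs_cons_cons (f := f) hxw hxw
      rw [Finset.filter_true_of_mem, Finset.filter_true_of_mem] at h1
      · rw [map_one, one_mul]
        exact h1
      · exact hfar y hx
      · intro p hp
        rw [mem_pairs] at hp
        have := hp.count y
        rw [Multiset.count_cons_self, Multiset.count_cons_self] at this
        by_cases hx1 : y ∈ p.1
        · by_cases hx2 : y ∈ p.2
          · exact ⟨hx1, hx2⟩
          · rw [if_pos hx1, if_neg hx2] at this; omega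
        · rw [if_neg hx1] at this; split_ifs at this <;> omega
    -- Neither point is near anything in `w`, so both distributions are possible for every pair.
    · refine ⟨2, ?_⟩
      rw [pairGen_cons_cons_of_ne hne hxy hxw hyw, Finset.filter_true_of_mem,
        Finset.filter_true_of_mem]
      · rw [pairGen, Polynomial.C_ofNat]
        ring
      · exact fun p hp => ⟨(hfar y hz p hp).1, (hfar x hx p hp).2⟩
      · exact fun p hp => ⟨(hfar x hx p hp).1, (hfar y hz p hp).2⟩

/-- The matched pairs among all pairs covering `w` are those with the first set of least size, and
the sizes of the first sets are distributed binomially. -/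
theorem exists_pairGen_eq (w : Multiset α) : ∃ c j₀ : ℕ, 2 * j₀ ≤ w.card ∧
    pairGen f w = Polynomial.C c * (Polynomial.X ^ j₀ * (1 + Polynomial.X) ^ (w.card - 2 * j₀)) ∧
    ∀ p ∈ pairs f w, j₀ ≤ p.1.card ∧ (Matched f p.1 p.2 ↔ p.1.card = j₀) := by
  induction hn : w.card using Nat.strong_induction_on generalizing w with
  | _ n ih =>
  subst hn
  by_cases hne : pairs f w = ∅
  -- If `w` has no covering pair, `c = 0` and the value of `j₀` is immaterial.
  · exact ⟨0, 0, by simp, by simp [pairGen, hne], by simp [hne]⟩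
  obtain ⟨p₀, hp₀⟩ := Finset.nonempty_iff_ne_empty.2 hne
  rw [mem_pairs] at hp₀
  by_cases hw : w = 0
  · subst hw
    have hp : pairs f 0 = {(∅, ∅)} := by
      ext p
      rw [mem_pairs, Finset.mem_singleton]
      constructor
      · intro h
        have := h.card
        rw [Multiset.card_zero] at this
        exact Prod.ext (Finset.card_eq_zero.1 (by omega)) (Finset.card_eq_zero.1 (by omega))
      · rintro rfl
        exact ⟨by simp [Separated], by simp [Separated], rfl⟩
    refine ⟨1, 0, by simp, by simp [pairGen, hp], ?_⟩
    intro p h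
    rw [hp, Finset.mem_singleton] at h
    subst h
    exact ⟨le_rfl, iff_of_true ⟨id, by simp, by simp⟩ rfl⟩
  obtain ⟨x, hxw, hmax⟩ := Finset.exists_max_image w.toFinset f
    (Multiset.toFinset_nonempty.2 hw)
  rw [Multiset.mem_toFinset] at hxw
  have hmax' : ∀ v ∈ w, f v ≤ f x := fun v hv => hmax v (Multiset.mem_toFinset.2 hv)
  clear hmax
  obtain ⟨w, rfl⟩ := Multiset.exists_cons_of_mem hxw
  by_cases hy : ∃ y ∈ w, Near f x y
  · obtain ⟨y, hyw, hxy⟩ := hy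
    obtain ⟨w, rfl⟩ := Multiset.exists_cons_of_mem hyw
    -- A second neighbour of the rightmost point would make three mutually near points.
    have hx : ∀ v ∈ w, ¬ Near f x v := by
      intro v hv hn
      have hfy := hmax' y (by simp)
      have hfv := hmax' v (by simp [hv])
      have hyv : Near f y v := Near.of_le hxy.symm hn.symm hfy hfv
      have := hp₀.card_le_two (Multiset.cons_le_cons x (Multiset.cons_le_cons y
        (Multiset.singleton_le.2 hv))) (by
        intro a ha b hb
        simp only [Multiset.mem_cons, Multiset.mem_singleton] at ha hb
        rcases ha with rfl | rfl | rfl <;> rcases hb with rfl | rfl | rfl <;>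
          first | exact near_refl _ | assumption | (apply Near.symm; assumption))
      simp at this
    -- A point at or to the right of `y` would lie between `y` and `x`, hence be near `x`.
    have hyv : ∀ v ∈ w, f v < f y := by
      intro v hv
      have h1 := hmax' v (by simp [hv])
      have h2 := hx v hv
      by_contra h3
      push Not at h3
      exact h2 ⟨by linarith [hxy.1], by linarith⟩
    have hxw : x ∉ w := fun h => hx x h (near_refl x)
    have hyw : y ∉ w := fun h => hx y h hxy
    obtain ⟨κ, hκ⟩ := pairGen_cons_cons hxy hx hyv hp₀
    obtain ⟨c, j₀, h1, h2, h3⟩ := ih w.card (by simp) w rfl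
    -- Each set gains one of the two points: the least size rises by one, and `|w| - 2j₀` is
    -- unchanged.
    refine ⟨κ * c, j₀ + 1, by simp; omega, ?_, ?_⟩
    · rw [hκ, h2]
      have : (x ::ₘ y ::ₘ w).card - 2 * (j₀ + 1) = w.card - 2 * j₀ := by simp; omega
      rw [this, map_mul]
      ring
    · rintro ⟨S, T⟩ hp
      rw [mem_pairs] at hp
      have hcases : (x ∈ S ∧ y ∈ T) ∨ (y ∈ S ∧ x ∈ T) := by
        have h1 : x ∈ S ∨ x ∈ T := hp.mem.1 (by simp)
        have h2 : y ∈ S ∨ y ∈ T := hp.mem.1 (by simp)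
        by_cases hyx : y = x
        · subst hyx
          have hc := hp.count y
          rw [Multiset.count_cons_self, Multiset.count_cons_self] at hc
          by_cases hx1 : y ∈ S
          · by_cases hx2 : y ∈ T
            · exact Or.inl ⟨hx1, hx2⟩
            · rw [if_pos hx1, if_neg hx2] at hc; omega
          · rw [if_neg hx1] at hc; split_ifs at hc <;> omega
        · have h3 : x ∈ S → y ∉ S := fun h h' => hyx (hp.1 y h' x h hxy.symm)
          have h4 : x ∈ T → y ∉ T := fun h h' => hyx (hp.2.1 y h' x h hxy.symm)
          tauto
      rcases hcases with ⟨hxS, hyT⟩ | ⟨hyS, hxT⟩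
      · rw [← Finset.insert_erase hxS, ← Finset.insert_erase hyT] at hp ⊢
        set S' := S.erase x with hS'
        set T' := T.erase y with hT'
        have hxS' : x ∉ S' := Finset.notMem_erase _ _
        have hyT' : y ∉ T' := Finset.notMem_erase _ _
        obtain ⟨hp', -⟩ := (isPair_insert_insert hxS' hyT').1 hp
        have h4 := h3 _ (mem_pairs.2 hp')
        simp only [Finset.card_insert_of_notMem hxS', add_left_inj] at h4 ⊢
        refine ⟨by omega, Iff.trans ⟨fun h => ?_, fun h => ?_⟩ h4.2⟩
        · exact h.of_insert_left hxS' fun v hv => hx v (hp'.mem.2 (Or.inr hv))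
        · exact h.insert_insert hxS' hyT' hxy
      · rw [← Finset.insert_erase hyS, ← Finset.insert_erase hxT] at hp ⊢
        set S' := S.erase y with hS'
        set T' := T.erase x with hT'
        have hyS' : y ∉ S' := Finset.notMem_erase _ _
        have hxT' : x ∉ T' := Finset.notMem_erase _ _
        rw [Multiset.cons_swap] at hp
        obtain ⟨hp', -⟩ := (isPair_insert_insert hyS' hxT').1 hp
        have h4 := h3 _ (mem_pairs.2 hp')
        simp only [Finset.card_insert_of_notMem hyS', add_left_inj] at h4 ⊢
        refine ⟨by omega, Iff.trans ⟨fun h => ?_, fun h => ?_⟩ h4.2⟩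
        -- Here `x` is in the second set, and only `y` could be matched to it; the other points of
        -- the first set are matched inside `T'`.
        · exact h.of_insert_right (Finset.subset_insert _ _)
            fun v hv => hx v (hp'.mem.2 (Or.inl hv))
        · exact h.insert_insert hyS' hxT' hxy.symm
  · push Not at hy
    obtain ⟨c, j₀, h1, h2, h3⟩ := ih w.card (by simp) w rfl
    -- The least size is attained with the isolated point in the second set. In the first set it has
    -- no partner, and the size exceeds `j₀`.
    refine ⟨c, j₀, by simp; omega, ?_, ?_⟩
    · rw [pairGen_cons_of_isolated hy, h2]
      have : (x ::ₘ w).card - 2 * j₀ = w.card - 2 * j₀ + 1 := by simp; omega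
      rw [this]
      ring
    · rintro ⟨S, T⟩ hp
      rw [mem_pairs] at hp
      by_cases hxS : x ∈ S
      · rw [← Finset.insert_erase hxS] at hp ⊢
        set S' := S.erase x with hS'
        have hxS' : x ∉ S' := Finset.notMem_erase _ _
        obtain ⟨hp', -⟩ := (isPair_insert_left hxS').1 hp
        have h4 := (h3 _ (mem_pairs.2 hp')).1
        simp only [Finset.card_insert_of_notMem hxS'] at h4 ⊢
        refine ⟨by omega, iff_of_false ?_ (by omega)⟩
        exact not_matched_of_isolated (Finset.mem_insert_self _ _)
          fun v hv => hy v (hp'.mem.2 (Or.inr hv))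
      · have hxT : x ∈ T := (hp.mem.1 (Multiset.mem_cons_self _ _)).resolve_left hxS
        rw [← Finset.insert_erase hxT] at hp ⊢
        set T' := T.erase x with hT'
        have hxT' : x ∉ T' := Finset.notMem_erase _ _
        obtain ⟨hp', -⟩ := (isPair_insert_right hxT').1 hp
        have h4 := h3 _ (mem_pairs.2 hp')
        refine ⟨h4.1, Iff.trans ⟨fun h => ?_, fun h => ?_⟩ h4.2⟩
        · exact h.of_insert_right subset_rfl fun v hv => hy v (hp'.mem.2 (Or.inl hv))
        · exact h.mono_right (Finset.subset_insert _ _)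

end Count

/-! ### The product of two elementary sums over separated sets -/

section PairSums

variable {α : Type*} [Fintype α] {f : α → ℝ}

theorem coeff_pairGen (w : Multiset α) (b : ℕ) :
    (pairGen f w).coeff b = ((pairs f w).filter fun p => p.1.card = b).card := by
  rw [pairGen, Polynomial.finsetSum_coeff, Finset.card_filter]
  refine Finset.sum_congr rfl fun p _ => ?_
  rw [Polynomial.coeff_X_pow]
  simp only [eq_comm]

/-- By `exists_pairGen_eq`, the only nonzero summand is the one at `j = j₀`, where all `c` pairs
with first set of size `j₀` are matched; the left side is the coefficient of `X^b`, namely `c` times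
the same binomial coefficient. -/
theorem card_pairs_eq_sum_matched (w : Multiset α) (a b : ℕ) :
    ((pairs f w).filter fun p => p.1.card = b ∧ p.2.card = a).card =
      ∑ j ∈ Finset.range (b + 1), (a + b - 2 * j).choose (b - j) *
        ((pairs f w).filter fun p => p.1.card = j ∧ p.2.card = a + b - j ∧
          Matched f p.1 p.2).card := by
  by_cases hw : w.card = a + b
  · obtain ⟨c, j₀, h1, h2, h3⟩ := exists_pairGen_eq (f := f) w
    have hcoeff : ∀ i, ((pairs f w).filter fun p => p.1.card = i).card =
        c * if j₀ ≤ i then (a + b - 2 * j₀).choose (i - j₀) else 0 := by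
      intro i
      rw [← coeff_pairGen, h2, Polynomial.coeff_C_mul, Polynomial.coeff_X_pow_mul', hw]
      simp only [Polynomial.coeff_one_add_X_pow, Nat.cast_id]
    have hL : ((pairs f w).filter fun p => p.1.card = b ∧ p.2.card = a) =
        (pairs f w).filter fun p => p.1.card = b := by
      refine Finset.filter_congr fun p hp => ⟨fun h => h.1, fun h => ⟨h, ?_⟩⟩
      have := (mem_pairs.1 hp).card
      omega
    have hR : ∀ j ∈ Finset.range (b + 1), ((pairs f w).filter fun p => p.1.card = j ∧
        p.2.card = a + b - j ∧ Matched f p.1 p.2) = if j = j₀ then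
          (pairs f w).filter fun p => p.1.card = j₀ else ∅ := by
      intro j hj
      have hjb := Finset.mem_range.1 hj
      split_ifs with h
      · subst h
        refine Finset.filter_congr fun p hp => ⟨fun h => h.1, fun h => ⟨h, ?_, ?_⟩⟩
        · have := (mem_pairs.1 hp).card
          omega
        · exact (h3 p hp).2.2 h
      · rw [Finset.filter_eq_empty_iff]
        rintro p hp ⟨h4, -, h5⟩
        exact h (h4.symm.trans ((h3 p hp).2.1 h5))
    rw [hL, hcoeff]
    by_cases hj : j₀ ≤ b
    · rw [Finset.sum_eq_single j₀]
      · rw [hR j₀ (Finset.mem_range.2 (by omega)), if_pos rfl, hcoeff, if_pos hj, if_pos le_rfl,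
          Nat.sub_self, Nat.choose_zero_right]
        ring
      · intro j hjr hne
        rw [hR j hjr, if_neg hne, Finset.card_empty, mul_zero]
      · intro h
        exact absurd (Finset.mem_range.2 (by omega)) h
    · rw [if_neg hj, mul_zero, eq_comm]
      refine Finset.sum_eq_zero fun j hjr => ?_
      have := Finset.mem_range.1 hjr
      rw [hR j hjr, if_neg (by omega), Finset.card_empty, mul_zero]
  · rw [Finset.filter_eq_empty_iff.2, Finset.card_empty, eq_comm]
    · refine Finset.sum_eq_zero fun j hjr => ?_
      have := Finset.mem_range.1 hjr
      rw [Finset.filter_eq_empty_iff.2, Finset.card_empty, mul_zero]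
      intro p hp h
      have := (mem_pairs.1 hp).card
      omega
    · intro p hp h
      have := (mem_pairs.1 hp).card
      omega

variable (f)

/-- The monomial of a pair of sets. -/
def pairMon (p : Finset α × Finset α) : MvPolynomial α ℝ :=
  (∏ v ∈ p.1, MvPolynomial.X v) * ∏ v ∈ p.2, MvPolynomial.X v

/-- The sum of the products over all separated sets of `i` points. -/
def elemSep (i : ℕ) : MvPolynomial α ℝ :=
  ∑ S : Finset α with S.card = i ∧ Separated f S, ∏ v ∈ S, MvPolynomial.X v

/-- The sum of the monomials of the pairs of separated sets of sizes `l` and `t`, the first of which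
can be matched into the second. -/
def matchedSum (l t : ℕ) : MvPolynomial α ℝ :=
  ∑ p : Finset α × Finset α with (Separated f p.1 ∧ Separated f p.2) ∧
    p.1.card = l ∧ p.2.card = t ∧ Matched f p.1 p.2, pairMon p

variable {f}

/-- The monomial of a pair depends only on the multiset it covers. Grouping by that multiset reduces
identities between such sums to identities between numbers of pairs. -/
theorem sum_pairMon_eq (Q : Finset α × Finset α → Prop) [DecidablePred Q] :
    ∑ p : Finset α × Finset α with (Separated f p.1 ∧ Separated f p.2) ∧ Q p, pairMon p =
      ∑ w ∈ Finset.univ.image fun p : Finset α × Finset α => p.1.val + p.2.val,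
        (((pairs f w).filter Q).card : ℝ) • (w.map MvPolynomial.X).prod := by
  rw [← Finset.sum_fiberwise_of_maps_to (g := fun p : Finset α × Finset α => p.1.val + p.2.val)
    (t := Finset.univ.image fun p : Finset α × Finset α => p.1.val + p.2.val)]
  · refine Finset.sum_congr rfl fun w _ => ?_
    have hset : ((Finset.univ.filter fun p : Finset α × Finset α =>
        (Separated f p.1 ∧ Separated f p.2) ∧ Q p).filter fun p => p.1.val + p.2.val = w) =
        (pairs f w).filter Q := by
      ext p
      simp only [Finset.mem_filter, Finset.mem_univ, true_and, mem_pairs, IsPair]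
      tauto
    rw [hset, Finset.sum_congr rfl (g := fun _ => (w.map MvPolynomial.X).prod),
      Finset.sum_const, Nat.cast_smul_eq_nsmul]
    intro p hp
    have h := (mem_pairs.1 (Finset.mem_filter.1 hp).1).2.2
    rw [← h, Multiset.map_add, Multiset.prod_add]
    rfl
  · intro p _
    exact Finset.mem_image_of_mem _ (Finset.mem_univ _)

theorem elemSep_mul_elemSep (a b : ℕ) : elemSep f b * elemSep f a =
    ∑ j ∈ Finset.range (b + 1), ((a + b - 2 * j).choose (b - j) : ℝ) •
      matchedSum f j (a + b - j) := by
  have hL : elemSep f b * elemSep f a = ∑ p : Finset α × Finset α with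
      (Separated f p.1 ∧ Separated f p.2) ∧ p.1.card = b ∧ p.2.card = a, pairMon p := by
    rw [elemSep, elemSep, Finset.sum_mul_sum, ← Finset.sum_product']
    refine Finset.sum_congr ?_ fun p _ => rfl
    ext p
    simp only [Finset.mem_product, Finset.mem_filter, Finset.mem_univ, true_and]
    tauto
  rw [hL, sum_pairMon_eq fun p => p.1.card = b ∧ p.2.card = a]
  have hR : ∀ j, matchedSum f j (a + b - j) = _ := fun j =>
    sum_pairMon_eq fun p => p.1.card = j ∧ p.2.card = a + b - j ∧ Matched f p.1 p.2
  simp only [hR, Finset.smul_sum]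
  rw [Finset.sum_comm]
  refine Finset.sum_congr rfl fun w _ => ?_
  rw [card_pairs_eq_sum_matched, Nat.cast_sum, Finset.sum_smul]
  refine Finset.sum_congr rfl fun j _ => ?_
  rw [Nat.cast_mul, mul_smul]

end PairSums

/-! ### Chains as separated sets, and the image of `m_{2^l,1^k}` -/

section Chains

variable {U : Type*} [PartialOrder U] {f : U → ℝ} (hf : ∀ w u : U, w < u ↔ f w + 1 ≤ f u)
include hf

theorem sim_iff_near (u v : U) : Sim u v ↔ Near f u v := by
  rw [Sim, Near, hf, hf, not_le, not_le, and_comm]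

theorem separated_image_of_strictMono {l : ℕ} {x : Fin l → U} (hx : StrictMono x) :
    Separated f (Finset.univ.image x) := by
  intro u hu v hv hn
  obtain ⟨i, -, rfl⟩ := Finset.mem_image.1 hu
  obtain ⟨j, -, rfl⟩ := Finset.mem_image.1 hv
  rw [← sim_iff_near hf] at hn
  rcases lt_trichotomy i j with h | h | h
  · exact absurd (hx h) hn.1
  · rw [h]
  · exact absurd (hx h) hn.2

theorem exists_strictMono_image_eq {S : Finset U} (hS : Separated f S) {l : ℕ}
    (hl : S.card = l) : ∃ x : Fin l → U, StrictMono x ∧ Finset.univ.image x = S := by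
  have hinj : Set.InjOn f S := fun u hu v hv h => hS u hu v hv ⟨by linarith, by linarith⟩
  have hc : (S.image f).card = l := by rw [Finset.card_image_of_injOn hinj, hl]
  have hmem : ∀ i : Fin l, ∃ u ∈ S, f u = (S.image f).orderEmbOfFin hc i := fun i =>
    Finset.mem_image.1 (Finset.orderEmbOfFin_mem _ hc i)
  choose x hxS hx using hmem
  have hmono : StrictMono x := by
    intro i j hij
    have h1 : f (x i) < f (x j) := by
      rw [hx, hx]
      exact (Finset.orderEmbOfFin _ hc).strictMono hij
    have h2 : ¬ Near f (x i) (x j) := fun h => by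
      rw [hS _ (hxS i) _ (hxS j) h] at h1
      exact lt_irrefl _ h1
    rw [hf]
    by_contra h3
    exact h2 ⟨by linarith, by linarith⟩
  refine ⟨x, hmono, Finset.eq_of_subset_of_card_le ?_ ?_⟩
  · intro u hu
    obtain ⟨i, -, rfl⟩ := Finset.mem_image.1 hu
    exact hxS i
  · rw [Finset.card_image_of_injective _ hmono.injective, hl, Finset.card_fin]

/-- Any matching along near points is order preserving: a crossing would put points of both chains
at distance at least 1 in opposite directions. -/
theorem matched_image_iff {l t : ℕ} {x : Fin l → U} {y : Fin t → U} (hx : StrictMono x)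
    (hy : StrictMono y) : Matched f (Finset.univ.image x) (Finset.univ.image y) ↔
      ∃ i : Fin l → Fin t, StrictMono i ∧ ∀ j, Sim (x j) (y (i j)) := by
  constructor
  · rintro ⟨g, hg, hgT⟩
    have hex : ∀ j, ∃ i, y i = g (x j) := fun j => by
      simpa using (hgT (x j) (Finset.mem_image_of_mem _ (Finset.mem_univ j))).1
    choose i hi using hex
    have hn : ∀ j, Near f (x j) (y (i j)) := fun j => by
      rw [hi]
      exact (hgT (x j) (Finset.mem_image_of_mem _ (Finset.mem_univ j))).2
    refine ⟨i, fun j j' hjj' => ?_, fun j => (sim_iff_near hf _ _).2 (hn j)⟩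
    rcases lt_trichotomy (i j) (i j') with h | h | h
    · exact h
    · have h1 : g (x j) = g (x j') := by rw [← hi, ← hi, h]
      have h2 := hx.injective (hg (by simp) (by simp) h1)
      exact absurd h2 hjj'.ne
    -- With `j < j'` but `i j' < i j`, this gives `x_j + 1 ≤ x_{j'} < y_{i j'} + 1 ≤ y_{i j} < x_j +
    -- 1`.
    · have h1 := (hf _ _).1 (hy h)
      have h2 := (hf _ _).1 (hx hjj')
      have h3 := (hn j).2
      have h4 := (hn j').1
      linarith
  · rintro ⟨i, hi, hs⟩
    have hinv : ∀ j, Function.extend x (fun j => y (i j)) id (x j) = y (i j) :=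
      hx.injective.extend_apply _ _
    refine ⟨Function.extend x (fun j => y (i j)) id, ?_, ?_⟩
    · intro u hu v hv huv
      obtain ⟨j, -, rfl⟩ := Finset.mem_image.1 (Finset.mem_coe.1 hu)
      obtain ⟨j', -, rfl⟩ := Finset.mem_image.1 (Finset.mem_coe.1 hv)
      rw [hinv, hinv] at huv
      rw [hi.injective (hy.injective huv)]
    · intro u hu
      obtain ⟨j, -, rfl⟩ := Finset.mem_image.1 hu
      rw [hinv]
      exact ⟨Finset.mem_image_of_mem _ (Finset.mem_univ _), (sim_iff_near hf _ _).1 (hs j)⟩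

variable [Fintype U]

theorem sum_chainPairs (l k : ℕ) :
    ∑ p ∈ chainPairs U l k, ((∏ j, MvPolynomial.X (p.1 j)) * ∏ j, MvPolynomial.X (p.2 j) :
      MvPolynomial U ℝ) = matchedSum f l (k + l) := by
  rw [matchedSum]
  refine Finset.sum_bij (fun p _ => (Finset.univ.image p.1, Finset.univ.image p.2)) ?_ ?_ ?_ ?_
  · rintro ⟨x, y⟩ hp
    obtain ⟨hx, hy, hi⟩ := (Finset.mem_filter.1 hp).2
    rw [Finset.mem_filter]
    refine ⟨Finset.mem_univ _, ⟨separated_image_of_strictMono hf hx,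
      separated_image_of_strictMono hf hy⟩, ?_, ?_, (matched_image_iff hf hx hy).2 hi⟩
    · rw [Finset.card_image_of_injective _ hx.injective, Finset.card_fin]
    · rw [Finset.card_image_of_injective _ hy.injective, Finset.card_fin]
  · rintro ⟨x, y⟩ hp ⟨x', y'⟩ hp' h
    obtain ⟨hx, hy, -⟩ := (Finset.mem_filter.1 hp).2
    obtain ⟨hx', hy', -⟩ := (Finset.mem_filter.1 hp').2
    have h1 := congrArg (fun q => (q.1 : Set U)) h
    have h2 := congrArg (fun q => (q.2 : Set U)) h
    simp only [Finset.coe_image, Finset.coe_univ, Set.image_univ] at h1 h2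
    exact Prod.ext ((hx.range_inj hx').1 h1) ((hy.range_inj hy').1 h2)
  · rintro ⟨S, T⟩ hp
    obtain ⟨⟨hS, hT⟩, hl, ht, hm⟩ := (Finset.mem_filter.1 hp).2
    obtain ⟨x, hx, rfl⟩ := exists_strictMono_image_eq hf hS hl
    obtain ⟨y, hy, rfl⟩ := exists_strictMono_image_eq hf hT ht
    exact ⟨(x, y), Finset.mem_filter.2 ⟨Finset.mem_univ _, hx, hy,
      (matched_image_iff hf hx hy).1 hm⟩, rfl⟩
  · rintro ⟨x, y⟩ hp
    obtain ⟨hx, hy, -⟩ := (Finset.mem_filter.1 hp).2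
    rw [pairMon, Finset.prod_image hx.injective.injOn, Finset.prod_image hy.injective.injOn]

theorem elemG_incGraph (i : ℕ) : elemG (incGraph U) i = elemSep f i := by
  rw [elemG, elemSep]
  refine Finset.sum_congr (Finset.filter_congr fun S _ => and_congr_right fun _ => ?_)
    fun _ _ => rfl
  have hadj : ∀ u v : U, u ≠ v → ((incGraph U).Adj u v ↔ Near f u v) := by
    intro u v huv
    rw [← sim_iff_near hf]
    change ¬ u ≤ v ∧ ¬ v ≤ u ↔ _
    rw [Sim, le_iff_lt_or_eq, le_iff_lt_or_eq]
    have := Ne.symm huv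
    tauto
  constructor
  · intro h u hu v hv hn
    by_contra huv
    exact h hu hv huv ((hadj u v huv).2 hn)
  · intro h u hu v hv huv hn
    exact huv (h u hu v hv ((hadj u v huv).1 hn))

theorem gHom_incGraph_e (i : ℕ) : gHom (incGraph U) (e i) = elemSep f i := by
  rcases Nat.eq_zero_or_pos i with rfl | hi
  · rw [e_zero, map_one, elemSep, Finset.sum_eq_single ∅]
    · simp
    · intro S hS hne
      exact absurd (Finset.card_eq_zero.1 (Finset.mem_filter.1 hS).2.1) hne
    · intro h
      exact absurd (Finset.mem_filter.2 ⟨Finset.mem_univ _, rfl, by simp [Separated]⟩) h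
  · rw [← elemG_incGraph hf]
    exact gHom_e (incGraph U) ⟨i, hi⟩

/-- Both expansions of the product of `e (k + l)` and `e l` are unitriangular: the term at index `l`
has coefficient 1, and the terms below it agree by induction. The induction is for all `k`, since
the number of ones changes with the index. -/
theorem gHom_twoOne (l k : ℕ) :
    gHom (incGraph U) (m (twoOne l k)) = matchedSum f l (k + l) := by
  induction l using Nat.strong_induction_on generalizing k with
  | _ l ih =>
  have h1 := congrArg (gHom (incGraph U)) (e_mul_e (k + l) l (by omega))
  rw [map_mul, gHom_incGraph_e hf, gHom_incGraph_e hf, mul_comm, elemSep_mul_elemSep, map_sum,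
    Finset.sum_range_succ, Finset.sum_range_succ] at h1
  have h2 : ∀ j ∈ Finset.range l, ((k + l + l - 2 * j).choose (l - j) : ℝ) •
      matchedSum f j (k + l + l - j) = gHom (incGraph U)
        (((k + l + l - 2 * j).choose (l - j) : ℝ) • m (twoOne j (k + l + l - 2 * j))) := by
    intro j hj
    have := Finset.mem_range.1 hj
    rw [map_smul, ih j this]
    congr 2
    omega
  rw [Finset.sum_congr rfl h2, add_right_inj, map_smul, Nat.sub_self, Nat.choose_zero_right,
    Nat.cast_one, one_smul, one_smul] at h1
  have h3 : k + l + l - 2 * l = k := by omega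
  have h4 : k + l + l - l = k + l := by omega
  rw [h3, h4] at h1
  exact h1.symm

end Chains

/-! ### Expansions in monomial symmetric functions -/

/-- An exponent vector whose nonzero entries are the parts of `lam`, listed from the index `0`. -/
def expVec (lam : Ptn) : ℕ →₀ ℕ := (lam.map fun i : ℕ+ => (i : ℕ)).toList.toFinsupp

theorem support_expVec (lam : Ptn) : (expVec lam).support = Finset.range (Multiset.card lam) := by
  ext i
  rw [expVec, List.toFinsupp_support, Finset.mem_filter, Multiset.length_toList,
    Multiset.card_map]
  refine and_iff_left_of_imp fun hi => ?_
  have hi' : i < (lam.map fun i : ℕ+ => (i : ℕ)).toList.length := by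
    simpa using hi
  rw [List.getD_eq_getElem _ _ hi']
  have := List.getElem_mem hi'
  rw [Multiset.mem_toList] at this
  obtain ⟨a, -, ha⟩ := Multiset.mem_map.1 this
  rw [← ha]
  exact a.ne_zero

theorem vals_expVec (lam : Ptn) :
    (expVec lam).support.val.map (expVec lam) = lam.map (fun i : ℕ+ => (i : ℕ)) := by
  rw [support_expVec]
  conv_rhs => rw [← Multiset.coe_toList (lam.map fun i : ℕ+ => (i : ℕ))]
  rw [Finset.range_val, Multiset.range, Multiset.map_coe]
  congr 1
  refine List.ext_getElem (by simp) fun i h1 h2 => ?_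
  rw [List.getElem_map, List.getElem_range, expVec, List.toFinsupp_apply,
    List.getD_eq_getElem _ _ h2]

theorem card_le_size (lam : Ptn) : Multiset.card lam ≤ lam.size := by
  rw [Ptn.size]
  have h := Multiset.card_nsmul_le_sum (s := lam.map fun i : ℕ+ => (i : ℕ)) (a := 1) (by
    intro x hx
    obtain ⟨a, -, rfl⟩ := Multiset.mem_map.1 hx
    exact a.pos)
  simpa using h

theorem exists_ptn_vals (d : ℕ →₀ ℕ) : ∃ lam : Ptn,
    lam.map (fun i : ℕ+ => (i : ℕ)) = d.support.val.map d ∧ lam.size = d.degree := by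
  have hpos : ∀ i ∈ d.support.val.map d, 0 < i := by
    intro i hi
    obtain ⟨j, hj, rfl⟩ := Multiset.mem_map.1 hi
    exact Nat.pos_of_ne_zero (Finsupp.mem_support_iff.1 hj)
  obtain ⟨lam, hlam⟩ : ∃ lam : Ptn, lam.map (fun i : ℕ+ => (i : ℕ)) = d.support.val.map d :=
    CanLift.prf (d.support.val.map d) hpos
  exact ⟨lam, hlam, by rw [Ptn.size, hlam]; rfl⟩

/-- A symmetric function has equal coefficients at all monomials of one type, so `expVec lam` can
represent the whole type. -/
theorem coeff_expVec {d : ℕ →₀ ℕ} {lam : Ptn}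
    (h : d.support.val.map d = lam.map (fun i : ℕ+ => (i : ℕ))) (g : SymFun) :
    MvPowerSeries.coeff (expVec lam) (g : MvPowerSeries ℕ ℝ) = MvPowerSeries.coeff d g.1 := by
  obtain ⟨π, hπ⟩ := exists_perm_of_vals ((vals_expVec lam).trans h.symm)
  rw [← hπ, coeff_embDomain_of_mem g.2]

instance (n : ℕ) : Fintype {lam : Ptn // lam.size ≤ n} :=
  have := finite_size_le n
  Fintype.ofFinite _

theorem coeff_sum_smul {ι : Type*} (s : Finset ι) (c : ι → ℝ) (g : ι → SymFun) (d : ℕ →₀ ℕ) :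
    MvPowerSeries.coeff d ((∑ i ∈ s, c i • g i : SymFun) : MvPowerSeries ℕ ℝ) =
      ∑ i ∈ s, c i * MvPowerSeries.coeff d (g i : MvPowerSeries ℕ ℝ) := by
  rw [AddSubmonoidClass.coe_finsetSum, map_sum]
  exact Finset.sum_congr rfl fun i _ => rfl

theorem eq_sum_coeff_smul_m {n : ℕ} {g : SymFun} (hg : DegLE n (g : MvPowerSeries ℕ ℝ)) :
    g = ∑ lam : {lam : Ptn // lam.size ≤ n},
      MvPowerSeries.coeff (expVec lam.1) (g : MvPowerSeries ℕ ℝ) • m lam.1 := by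
  apply Subtype.ext
  ext d
  rw [coeff_sum_smul]
  obtain ⟨lam, hlam, hsize⟩ := exists_ptn_vals d
  have hm : ∀ mu : Ptn, MvPowerSeries.coeff d (m mu : MvPowerSeries ℕ ℝ) =
      if mu = lam then 1 else 0 := by
    intro mu
    refine (coeff_monoSeries mu d).trans ?_
    rw [← hlam]
    congr 1
    rw [eq_iff_iff]
    exact ⟨fun h => (Multiset.map_injective PNat.coe_injective h).symm, fun h => by rw [h]⟩
  simp only [hm, mul_ite, mul_one, mul_zero]
  by_cases hd : d.degree ≤ n
  · rw [Finset.sum_eq_single ⟨lam, hsize ▸ hd⟩]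
    · rw [if_pos rfl, coeff_expVec hlam.symm]
    · intro mu _ hne
      rw [if_neg fun h => hne (Subtype.ext h)]
    · intro h
      exact absurd (Finset.mem_univ _) h
  · rw [Finset.sum_eq_zero]
    · by_contra h
      exact hd (hg d h)
    · rintro ⟨mu, hmu⟩ _
      rw [if_neg]
      rintro rfl
      exact hd (hsize ▸ hmu)

theorem eq_of_coeff_expVec_eq {n : ℕ} {g h : SymFun} (hg : DegLE n (g : MvPowerSeries ℕ ℝ))
    (hh : DegLE n (h : MvPowerSeries ℕ ℝ)) (H : ∀ lam : Ptn, lam.size ≤ n →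
      MvPowerSeries.coeff (expVec lam) (g : MvPowerSeries ℕ ℝ) =
        MvPowerSeries.coeff (expVec lam) (h : MvPowerSeries ℕ ℝ)) : g = h := by
  rw [eq_sum_coeff_smul_m hg, eq_sum_coeff_smul_m hh]
  exact Finset.sum_congr rfl fun lam _ => by rw [H lam.1 lam.2]

/-! ### Products of elementary symmetric functions -/

/-- Expanding the product chooses one set for each factor, and the exponent of `v` is the number of
chosen sets containing it. It is used both for products of elementary symmetric functions and for
products of sums over stable sets. -/
theorem coeff_prod_sum_sets {ι V : Type*} [Fintype ι] [DecidableEq ι] [Fintype V]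
    [DecidableEq V] (A : ι → Finset (Finset V))
    (d : V →₀ ℕ) : MvPolynomial.coeff d
      (∏ i, ∑ S ∈ A i, ∏ v ∈ S, (MvPolynomial.X v : MvPolynomial V ℝ)) =
      (((Fintype.piFinset A).filter fun p => ∀ v, (Finset.univ.filter fun i => v ∈ p i).card =
        d v).card : ℝ) := by
  rw [Finset.prod_univ_sum, MvPolynomial.coeff_sum, Finset.card_filter, Nat.cast_sum]
  refine Finset.sum_congr rfl fun p _ => ?_
  have hmon : ∏ i, ∏ v ∈ p i, (MvPolynomial.X v : MvPolynomial V ℝ) =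
      MvPolynomial.monomial (∑ i, indic (p i)) 1 := by
    rw [MvPolynomial.monomial_sum_one]
    refine Finset.prod_congr rfl fun i _ => ?_
    rw [indic, MvPolynomial.monomial_sum_one]
    rfl
  rw [hmon, MvPolynomial.coeff_monomial, Nat.cast_ite, Nat.cast_one, Nat.cast_zero]
  congr 1
  rw [eq_iff_iff, DFunLike.ext_iff]
  refine forall_congr' fun v => ?_
  rw [Finsupp.finsetSum_apply, Finset.card_filter]
  simp only [indic_apply]

/-- The product of the elementary symmetric functions `e_{a_i}`. -/
def eFamily {n : ℕ} (a : Fin n → ℕ) : SymFun := ∏ i, e (a i)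

theorem coeff_eFamily {n : ℕ} (a b : Fin n → ℕ) :
    MvPowerSeries.coeff ((Finsupp.equivFunOnFinite.symm b).embDomain Fin.valEmbedding)
      (eFamily a : MvPowerSeries ℕ ℝ) =
      ((Finset.univ.filter fun p : Fin n → Finset (Fin n) => (∀ i, (p i).card = a i) ∧
        ∀ v, (Finset.univ.filter fun i => v ∈ p i).card = b v).card : ℝ) := by
  rw [← MvPowerSeries.coeff_killCompl]
  have h : MvPowerSeries.killCompl (Fin.valEmbedding (n := n)) (eFamily a : MvPowerSeries ℕ ℝ) =
      ((∏ i, MvPolynomial.esymm (Fin n) ℝ (a i) : MvPolynomial (Fin n) ℝ) :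
        MvPowerSeries (Fin n) ℝ) := by
    rw [eFamily, SubmonoidClass.coe_finsetProd, map_prod, ← MvPolynomial.coeToMvPowerSeries.ringHom_apply,
      map_prod]
    exact Finset.prod_congr rfl fun i _ => killCompl_elemSeries n (a i)
  rw [h, MvPolynomial.coeff_coe]
  simp only [MvPolynomial.esymm]
  rw [coeff_prod_sum_sets]
  congr 2
  ext p
  simp [Fintype.mem_piFinset, Finset.mem_powersetCard]

/-- Both sides count 0-1 matrices with prescribed row and column sums, and transposition exchanges
the two. Both index sets are `Fin n`, so that the matrices are square. -/
theorem coeff_eFamily_comm {n : ℕ} (a b : Fin n → ℕ) :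
    MvPowerSeries.coeff ((Finsupp.equivFunOnFinite.symm b).embDomain Fin.valEmbedding)
      (eFamily a : MvPowerSeries ℕ ℝ) =
    MvPowerSeries.coeff ((Finsupp.equivFunOnFinite.symm a).embDomain Fin.valEmbedding)
      (eFamily b : MvPowerSeries ℕ ℝ) := by
  rw [coeff_eFamily, coeff_eFamily, Nat.cast_inj]
  refine Finset.card_bij' (fun p _ v => Finset.univ.filter fun i => v ∈ p i)
    (fun p _ v => Finset.univ.filter fun i => v ∈ p i) ?_ ?_ ?_ ?_
  · intro p hp
    simpa [and_comm] using hp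
  · intro p hp
    simpa [and_comm] using hp
  · intro p hp
    ext; simp
  · intro p hp
    ext; simp

theorem degLE_eFamily {n : ℕ} (a : Fin n → ℕ) :
    DegLE (∑ i, a i) (eFamily a : MvPowerSeries ℕ ℝ) := by
  have h : ∀ s : Finset (Fin n), DegLE (∑ i ∈ s, a i) ((∏ i ∈ s, e (a i) : SymFun) :
      MvPowerSeries ℕ ℝ) := by
    intro s
    induction s using Finset.induction_on with
    | empty => simpa using degLE_C 1
    | insert i s hi ih =>
      rw [Finset.sum_insert hi, Finset.prod_insert hi]
      exact (degLE_elemSeries (a i)).mul ih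
  exact h Finset.univ

/-- The first `n` entries of the exponent vector of a partition. -/
def expFin (n : ℕ) (lam : Ptn) : Fin n → ℕ := fun i => expVec lam i

theorem embDomain_expFin {n : ℕ} {lam : Ptn} (h : lam.size ≤ n) :
    (Finsupp.equivFunOnFinite.symm (expFin n lam)).embDomain Fin.valEmbedding = expVec lam := by
  ext j
  by_cases hj : j < n
  · exact Finsupp.embDomain_apply_self Fin.valEmbedding _ (⟨j, hj⟩ : Fin n)
  · rw [Finsupp.embDomain_of_notMem_range, eq_comm, ← Finsupp.notMem_support_iff, support_expVec,
      Finset.mem_range]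
    · have := card_le_size lam
      omega
    · rintro ⟨i, rfl⟩
      exact hj i.2

/-- The condition `φ 0 = 1` makes the padding by zeros harmless. With values in `Multiplicative ℕ`
it also yields the statement for sums. -/
theorem prod_expFin {M : Type*} [CommMonoid M] {n : ℕ} {lam : Ptn} (h : lam.size ≤ n)
    (φ : ℕ → M) (hφ : φ 0 = 1) :
    ∏ i, φ (expFin n lam i) = (lam.map fun i : ℕ+ => φ i).prod := by
  have h1 : (lam.map fun i : ℕ+ => φ i) = (lam.map fun i : ℕ+ => (i : ℕ)).map φ := by
    rw [Multiset.map_map]; rfl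
  rw [h1, ← vals_expVec, Multiset.map_map]
  change _ = ∏ i ∈ (expVec lam).support, φ (expVec lam i)
  simp only [expFin]
  rw [← Finset.prod_range (fun i => φ (expVec lam i)) (n := n)]
  symm
  refine Finset.prod_subset ?_ ?_
  · rw [support_expVec]
    exact Finset.range_subset_range.2 ((card_le_size lam).trans h)
  · intro i _ hi
    rw [Finsupp.notMem_support_iff.1 hi, hφ]

theorem eFamily_expFin {n : ℕ} {lam : Ptn} (h : lam.size ≤ n) :
    eFamily (expFin n lam) = eProd lam :=
  prod_expFin h e e_zero

theorem sum_expFin {n : ℕ} {lam : Ptn} (h : lam.size ≤ n) : ∑ i, expFin n lam i = lam.size := by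
  have := prod_expFin h (fun i => Multiplicative.ofAdd i) rfl
  rw [← ofAdd_sum] at this
  have h2 : (lam.map fun i : ℕ+ => Multiplicative.ofAdd (i : ℕ)).prod =
      Multiplicative.ofAdd lam.size := by
    rw [Ptn.size, ofAdd_multiset_prod, Multiset.map_map]
    rfl
  exact Multiplicative.ofAdd.injective (this.trans h2)

/-! ### The coefficients of the chromatic symmetric function -/

section Chromatic

variable {V : Type*} [Fintype V] (G : SimpleGraph V)

theorem gHom_e_nat (i : ℕ) : gHom G (e i) = elemG G i := by
  rcases Nat.eq_zero_or_pos i with rfl | hi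
  · rw [e_zero, map_one, elemG, Finset.sum_eq_single ∅]
    · simp
    · intro S hS hne
      exact absurd (Finset.card_eq_zero.1 (Finset.mem_filter.1 hS).2.1) hne
    · intro h
      exact absurd (Finset.mem_filter.2 ⟨Finset.mem_univ _, rfl, by simp⟩) h
  · exact gHom_e G ⟨i, hi⟩

/-- The coefficient of the product of all vertices. -/
def fullCoeff : SymFun →ₗ[ℝ] ℝ :=
  (MvPolynomial.lcoeff ℝ (indic Finset.univ)).comp (gHom G).toLinearMap

theorem colorExp_apply (c : G.Coloring ℕ) (j : ℕ) :
    colorExp c j = (Finset.univ.filter fun v => c v = j).card := by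
  rw [colorExp, Finsupp.finsetSum_apply, Finset.card_filter]
  exact Finset.sum_congr rfl fun v _ => by rw [Finsupp.single_apply]

/-- A squarefree full monomial arises from a family of stable sets partitioning the vertices, with
`a i` vertices in the `i`-th set. Such a family is the family of color classes of a proper coloring
with monomial `x^a`. -/
theorem fullCoeff_eFamily {n : ℕ} (a : Fin n → ℕ) : fullCoeff G (eFamily a) =
    MvPowerSeries.coeff ((Finsupp.equivFunOnFinite.symm a).embDomain Fin.valEmbedding)
      (chromSym G : MvPowerSeries ℕ ℝ) := by
  have hL : fullCoeff G (eFamily a) = MvPolynomial.coeff (indic Finset.univ)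
      (∏ i, elemG G (a i)) := by
    simp only [← gHom_e_nat]
    rw [← map_prod]
    rfl
  rw [hL]
  simp only [elemG]
  rw [coeff_prod_sum_sets]
  refine Eq.trans ?_ (coeff_chromSeries G _).symm
  rw [Nat.cast_inj, ← Fintype.card_coe, ← Nat.card_eq_fintype_card]
  symm
  have hval : ∀ i : Fin n, (Finsupp.equivFunOnFinite.symm a).embDomain Fin.valEmbedding (i : ℕ) =
      a i := fun i => Finsupp.embDomain_apply_self Fin.valEmbedding _ i
  have hlt : ∀ c : G.Coloring ℕ, colorExp c =
      (Finsupp.equivFunOnFinite.symm a).embDomain Fin.valEmbedding → ∀ v, c v < n := by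
    intro c hc v
    by_contra hv
    have h1 := DFunLike.congr_fun hc (c v)
    rw [Finsupp.embDomain_of_notMem_range, colorExp_apply, Finset.card_eq_zero,
      Finset.filter_eq_empty_iff] at h1
    · exact h1 (Finset.mem_univ v) rfl
    · rintro ⟨i, hi⟩
      exact hv (hi ▸ i.2)
  refine Nat.card_congr (Equiv.ofBijective (fun c => ⟨fun i : Fin n =>
    Finset.univ.filter fun v => c.1 v = i, ?_⟩) ⟨?_, ?_⟩)
  · obtain ⟨c, hc⟩ := c
    rw [Finset.mem_filter, Fintype.mem_piFinset]
    refine ⟨fun i => ?_, fun v => ?_⟩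
    · rw [Finset.mem_filter]
      refine ⟨Finset.mem_univ _, ?_, ?_⟩
      · rw [← colorExp_apply, hc, hval]
      · intro v hv w hw _ hadj
        have hv' : c v = i := by simpa using hv
        have hw' : c w = i := by simpa using hw
        exact c.valid hadj (hv'.trans hw'.symm)
    · rw [indic_apply, if_pos (Finset.mem_univ v), Finset.card_eq_one]
      refine ⟨⟨c v, hlt c hc v⟩, ?_⟩
      ext i
      simp [Fin.ext_iff, eq_comm]
  · rintro ⟨c, hc⟩ ⟨c', hc'⟩ h
    apply Subtype.ext
    apply RelHom.ext
    intro v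
    have h1 := congrFun (congrArg Subtype.val h) ⟨c v, hlt c hc v⟩
    have h2 : v ∈ Finset.univ.filter fun w => c w = c v := by simp
    exact ((Finset.mem_filter.1 (h1.subset h2)).2).symm
  · rintro ⟨p, hp⟩
    rw [Finset.mem_filter, Fintype.mem_piFinset] at hp
    obtain ⟨hp1, hp2⟩ := hp
    -- Exponent 1 at `v` means that exactly one set of the family contains `v`; its index is the
    -- color.
    have hex : ∀ v, ∃ i, ∀ j, v ∈ p j ↔ j = i := by
      intro v
      have h1 := hp2 v
      rw [indic_apply, if_pos (Finset.mem_univ v), Finset.card_eq_one] at h1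
      obtain ⟨i, hi⟩ := h1
      refine ⟨i, fun j => ?_⟩
      rw [← Finset.mem_singleton, ← hi]
      simp
    choose c hc using hex
    have hvalid : ∀ {v w : V}, G.Adj v w → ((c v : Fin n) : ℕ) ≠ c w := by
      intro v w hadj h
      have h1 := (Finset.mem_filter.1 (hp1 (c v))).2.2
      exact h1 (Finset.mem_coe.2 ((hc v _).2 rfl))
        (Finset.mem_coe.2 ((hc w _).2 (Fin.ext h))) hadj.ne hadj
    have hset : ∀ i : Fin n, (Finset.univ.filter fun v => ((c v : Fin n) : ℕ) = i) = p i := by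
      intro i
      ext v
      rw [Finset.mem_filter, hc v i, Fin.ext_iff, eq_comm]
      simp
    refine ⟨⟨SimpleGraph.Coloring.mk (fun v => ((c v : Fin n) : ℕ)) hvalid, ?_⟩, ?_⟩
    · ext j
      rw [colorExp_apply]
      by_cases hj : j < n
      · have h1 := hset ⟨j, hj⟩
        have h2 := hval ⟨j, hj⟩
        simp only at h1 h2
        rw [h2, ← (Finset.mem_filter.1 (hp1 ⟨j, hj⟩)).2.1, ← h1]
        rfl
      · rw [Finsupp.embDomain_of_notMem_range, Finset.card_eq_zero, Finset.filter_eq_empty_iff]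
        · intro v _ h
          exact hj (h ▸ (c v).2)
        · rintro ⟨i, rfl⟩
          exact hj i.2
    · apply Subtype.ext
      funext i
      exact hset i

theorem degLE_chromSym : DegLE (Fintype.card V) (chromSym G : MvPowerSeries ℕ ℝ) := by
  intro d hd
  change MvPowerSeries.coeff d (chromSeries G) ≠ 0 at hd
  rw [coeff_chromSeries, Nat.cast_ne_zero] at hd
  obtain ⟨⟨c, rfl⟩⟩ := (Nat.card_ne_zero.1 hd).1
  simp [colorExp, map_sum, Finsupp.degree_single]

/-- Compare coefficients of `x^μ`. On the left it is the full coefficient of `e_μ`, which expands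
through the coefficients of `x^λ` in `e_μ`; by `coeff_eFamily_comm` these equal the coefficients of
`x^μ` in `e_λ`. Summing over all sizes up to `|V|` makes homogeneity of `X_G` unnecessary. -/
theorem chromSym_eq_sum : chromSym G = ∑ lam : {lam : Ptn // lam.size ≤ Fintype.card V},
    fullCoeff G (m lam.1) • eProd lam.1 := by
  refine eq_of_coeff_expVec_eq (degLE_chromSym G) ?_ fun mu hmu => ?_
  · have h : ∑ lam : {lam : Ptn // lam.size ≤ Fintype.card V},
        fullCoeff G (m lam.1) • eProd lam.1 ∈ symLE (Fintype.card V) :=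
      Submodule.sum_mem _ fun lam _ => Submodule.smul_mem _ _ ((degLE_eProd lam.1).mono lam.2)
    exact h
  · have hdeg : DegLE (Fintype.card V)
        (eFamily (expFin (Fintype.card V) mu) : MvPowerSeries ℕ ℝ) :=
      (degLE_eFamily _).mono (sum_expFin hmu ▸ hmu)
    have h1 := fullCoeff_eFamily G (expFin (Fintype.card V) mu)
    rw [embDomain_expFin hmu, eq_sum_coeff_smul_m hdeg, map_sum] at h1
    rw [← h1, coeff_sum_smul]
    refine Finset.sum_congr rfl fun lam _ => ?_
    rw [map_smul, smul_eq_mul, mul_comm, ← eFamily_expFin lam.2, ← embDomain_expFin lam.2,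
      coeff_eFamily_comm, embDomain_expFin hmu]

theorem eCoeff_eq_fullCoeff {lam : Ptn} (h : lam.size ≤ Fintype.card V) :
    eCoeff G lam = fullCoeff G (m lam) := by
  rw [eCoeff, chromSym_eq_sum, map_sum, Finsupp.finsetSum_apply,
    Finset.sum_eq_single ⟨lam, h⟩]
  · rw [map_smul, ← eBasis_apply, Module.Basis.repr_self]
    simp
  · intro mu _ hne
    rw [map_smul, ← eBasis_apply, Module.Basis.repr_self, Finsupp.smul_apply,
      Finsupp.single_eq_of_ne, smul_zero]
    exact fun h => hne (Subtype.ext h.symm)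
  · intro h
    exact absurd (Finset.mem_univ _) h

end Chromatic

/-! ### Positivity of the coefficients -/

theorem size_twoOne (l k : ℕ) : (twoOne l k).size = 2 * l + k := by
  simp [twoOne, Ptn.size, mul_comm]

end ChromSym

end

theorem mainTheorem5 (U : Type*) [Fintype U] [PartialOrder U]
    (hU : ChromSym.IsUnitIntervalOrder U) :
    (∀ l k : ℕ,
      ChromSym.gHom (ChromSym.incGraph U) (ChromSym.m (ChromSym.twoOne l k)) =
        ∑ p ∈ ChromSym.chainPairs U l k,
          (∏ j, MvPolynomial.X (p.1 j)) * ∏ j, MvPolynomial.X (p.2 j)) ∧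
    ∀ k : ℕ, 2 * k ≤ Fintype.card U →
      0 ≤ ChromSym.eCoeff (ChromSym.incGraph U)
        (ChromSym.twoOne k (Fintype.card U - 2 * k)) := by
  obtain ⟨-, f, -, hf⟩ := hU
  have hm : ∀ l k : ℕ,
      ChromSym.gHom (ChromSym.incGraph U) (ChromSym.m (ChromSym.twoOne l k)) =
        ∑ p ∈ ChromSym.chainPairs U l k,
          (∏ j, MvPolynomial.X (p.1 j)) * ∏ j, MvPolynomial.X (p.2 j) := fun l k => by
    rw [ChromSym.sum_chainPairs hf, ChromSym.gHom_twoOne hf]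
  refine ⟨hm, fun k hk => ?_⟩
  rw [ChromSym.eCoeff_eq_fullCoeff _ (by rw [ChromSym.size_twoOne]; omega)]
  change 0 ≤ MvPolynomial.coeff _ (ChromSym.gHom _ _)
  rw [hm, MvPolynomial.coeff_sum]
  -- Each pair of chains contributes a monomial with coefficient 1, hence 0 or 1 to the chosen
  -- coefficient.
  refine Finset.sum_nonneg fun p _ => ?_
  have hmon : ∀ (r : ℕ) (x : Fin r → U), ∏ j, (MvPolynomial.X (x j) : MvPolynomial U ℝ) =
      MvPolynomial.monomial (∑ j, Finsupp.single (x j) 1) 1 := fun r x => by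
    rw [MvPolynomial.monomial_sum_one]
    rfl
  classical
  rw [hmon, hmon, MvPolynomial.monomial_mul, MvPolynomial.coeff_monomial]
  split_ifs <;> simp
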